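/- Let $H:\mathbb R\to\mathbb R$ be a smooth, nonnegative, even function with $xH'(x)<0$ for $0<|x|<1$, $xH'(x)>0$ for $|x|>1$, $H(\pm1)=H'(\pm1)=H'(0)=0$, $H(0)=H(\pm2)=1$ and $H''(0)<0<H''(\pm1)$. Put $\tau_\varepsilon=\varepsilon^{-2}e^{-1/\varepsilon^2}$ and $k=\pi^{-1}\sqrt{|H''(0)|\,H''(1)}$. Let $\varepsilon_0>0$ be such that $Z_\varepsilon=\int_{\mathbb R}e^{-H(y)/\varepsilon^2}\,dy<\infty$ for all $\varepsilon\in(0,\varepsilon_0)$, and put $\gamma_\varepsilon=Z_\varepsilon^{-1}e^{-H/\varepsilon^2}$. For each $\varepsilon\in(0,\varepsilon_0)$ let $\rho_\varepsilon:[0,\infty)\times\mathbb R\to[0,\infty)$, with $\rho_\varepsilon(t,\cdot)$ a probability density for every $t\ge0$, be a classical solution ($C^1$ in $t$ and $C^2$ in $x$ for $t>0$) of the rescaled Kramers–Smoluchowski equation $$\tau_\varepsilon\,\partial_t\rho_\varepsilon=\partial_x\big(\partial_x\rho_\varepsilon+\varepsilon^{-2}\rho_\varepsilon H'\big),\qquad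 x\in\mathbb R,\ t>0,$$ with initial datum $\rho_\varepsilon(0,\cdot)=\rho_\varepsilon^0$, attained in the weak$\star$ sense of probability measures as $t\downarrow0$. Suppose that the probability measures $\rho_\varepsilon^0\,dx$ converge weakly$\star$ to a probability measure $\rho^0$ on $\mathbb R$ as $\varepsilon\to0$, and that $u_\varepsilon^0=\rho_\varepsilon^0/\gamma_\varepsilon$ has a weak derivative and satisfies $$\int_{\mathbb R}\gamma_\varepsilon|u_\varepsilon^0|^2\,dx+\int_{\mathbb R}\frac{\gamma_\varepsilon|\partial_xu_\varepsilon^0|^2}{\tau_\varepsilon}\,dx\le C,\qquad u_\varepsilon^0(x)\ge c>0\quad\text{for all }x\in\mathbb R,$$ with constants $C$ and $c$ independent of $\varepsilon$. Then, for all $t\ge0$, $$\rho_\varepsilon(t,\cdot)\,dx\ \longrightarrow\ \tfrac12\big(u(t)\,\delta_{+1}+(2-u(t))\,\delta_{-1}\big)\qquad\text{as }\varepsilon\to0$$ weakly$\star$ in the space of probability measures, where $u:[0,\infty)\to[0,2]$ satisfies $\dot u=-k(u-1)$ and $u(0)=2\rho^0((0,\infty))$. -/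

import Mathlib

open MeasureTheory Filter Topology Set
open scoped ContDiff

noncomputable section

namespace Kramers

/-- A typical double-well enthalpy function with wells at `±1` and barrier of height one
at `0`. -/
structure IsDoubleWell (H : ℝ → ℝ) : Prop where
  smooth : ContDiff ℝ ∞ H
  nonneg : ∀ x, 0 ≤ H x
  even : Function.Even H
  deriv_inner : ∀ x, 0 < |x| → |x| < 1 → x * deriv H x < 0
  deriv_outer : ∀ x, 1 < |x| → 0 < x * deriv H x
  well : H 1 = 0 ∧ H (-1) = 0
  deriv_well : deriv H 1 = 0 ∧ deriv H (-1) = 0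
  deriv_barrier : deriv H 0 = 0
  barrier : H 0 = 1
  at_two : H 2 = 1 ∧ H (-2) = 1
  deriv2_barrier : deriv (deriv H) 0 < 0
  deriv2_well : 0 < deriv (deriv H) 1 ∧ 0 < deriv (deriv H) (-1)

/-- The time scale `τ_ε = ε⁻² e^{-1/ε²}`. -/
def tau (ε : ℝ) : ℝ := (ε ^ 2)⁻¹ * Real.exp (-1 / ε ^ 2)

/-- Kramers' constant `k = π⁻¹ √(|H''(0)| H''(1))`. -/
def rate (H : ℝ → ℝ) : ℝ :=
  Real.pi⁻¹ * Real.sqrt (|deriv (deriv H) 0| * deriv (deriv H) 1)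

/-- The normalization constant `Z_ε = ∫ e^{-H/ε²}`. -/
def partitionFn (H : ℝ → ℝ) (ε : ℝ) : ℝ := ∫ y, Real.exp (-H y / ε ^ 2)

/-- The density `γ_ε = Z_ε⁻¹ e^{-H/ε²}` of the invariant measure. -/
def gam (H : ℝ → ℝ) (ε : ℝ) (x : ℝ) : ℝ :=
  (partitionFn H ε)⁻¹ * Real.exp (-H x / ε ^ 2)

/-- Probability densities on the real line. -/
structure ProbDensity where
  /-- the density as a function -/
  toFun : ℝ → ℝ
  nonneg : ∀ x, 0 ≤ toFun x
  integrable : Integrable toFun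
  integral_eq_one : ∫ x, toFun x = 1

instance : CoeFun ProbDensity (fun _ => ℝ → ℝ) := ⟨ProbDensity.toFun⟩

/-- The probability measure `ρ dx` with density `ρ`. -/
def ProbDensity.law (ρ : ProbDensity) : ProbabilityMeasure ℝ :=
  ⟨volume.withDensity (fun x => ENNReal.ofReal (ρ x)), ⟨by
    rw [withDensity_apply _ MeasurableSet.univ, Measure.restrict_univ,
      ← ofReal_integral_eq_lintegral_ofReal ρ.integrable (ae_of_all _ ρ.nonneg),
      ρ.integral_eq_one, ENNReal.ofReal_one]⟩⟩

/-- `g` is the weak (distributional) derivative of `f` on the real line. -/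
def HasWeakDeriv (f g : ℝ → ℝ) : Prop :=
  LocallyIntegrable f ∧ LocallyIntegrable g ∧
    ∀ φ : ℝ → ℝ, ContDiff ℝ ∞ φ → HasCompactSupport φ →
      ∫ x, f x * deriv φ x = -∫ x, g x * φ x

/-- `ρ` is a classical solution (`C¹` in time and `C²` in space for positive times), within the
probability densities, of the rescaled Kramers–Smoluchowski equation
`τ_ε ∂ₜρ = ∂ₓ(∂ₓρ + ε⁻² ρ H')` on `(0,∞) × ℝ`, and it attains its initial datum `ρ₀` in the
weak-star sense as `t ↓ 0`. Only the times `t ≥ 0` matter. -/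
structure IsSolution (H : ℝ → ℝ) (ε : ℝ) (ρ : ℝ → ProbDensity) (ρ₀ : ProbDensity) : Prop where
  contDiff_space : ∀ t, 0 < t → ContDiff ℝ 2 (ρ t)
  differentiable_time : ∀ t, 0 < t → ∀ x, DifferentiableAt ℝ (fun s => ρ s x) t
  continuousOn : ContinuousOn (fun p : ℝ × ℝ => ρ p.1 p.2) (Ioi 0 ×ˢ univ)
  continuousOn_dt :
    ContinuousOn (fun p : ℝ × ℝ => deriv (fun s => ρ s p.2) p.1) (Ioi 0 ×ˢ univ)
  continuousOn_dx : ContinuousOn (fun p : ℝ × ℝ => deriv (ρ p.1) p.2) (Ioi 0 ×ˢ univ)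
  continuousOn_dxx :
    ContinuousOn (fun p : ℝ × ℝ => deriv (deriv (ρ p.1)) p.2) (Ioi 0 ×ˢ univ)
  equation : ∀ t, 0 < t → ∀ x,
    tau ε * deriv (fun s => ρ s x) t =
      deriv (fun y => deriv (ρ t) y + (ε ^ 2)⁻¹ * ρ t y * deriv H y) x
  initial : ρ 0 = ρ₀
  attained : Tendsto (fun t => (ρ t).law) (𝓝[>] 0) (𝓝 ρ₀.law)

/-- Well-preparedness of the initial datum `ρ₀`, where `u₀ = ρ₀ / γ_ε`:
`∫ γ_ε |u₀|² + ∫ γ_ε |∂ₓu₀|² / τ_ε ≤ C` and `u₀ ≥ c`. -/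
structure IsWellPrepared (H : ℝ → ℝ) (ε C c : ℝ) (ρ₀ : ProbDensity) : Prop where
  energy : ∃ du : ℝ → ℝ, HasWeakDeriv (fun x => ρ₀ x / gam H ε x) du ∧
    Integrable (fun x => gam H ε x * (ρ₀ x / gam H ε x) ^ 2) ∧
    Integrable (fun x => gam H ε x * du x ^ 2 / tau ε) ∧
    (∫ x, gam H ε x * (ρ₀ x / gam H ε x) ^ 2) + (∫ x, gam H ε x * du x ^ 2 / tau ε) ≤ C
  lower : ∀ x, c ≤ ρ₀ x / gam H ε x

end Kramers

end

/-! Testing the equation with f gives d/dt ∫ρ f = ∫ρ Lf, where L = τ⁻¹(∂ₓ² − ε⁻²H'∂ₓ). Everything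
follows from good choices of f.

Concentration. For every h > 0 the mass of {H ≥ h} tends to zero uniformly on bounded time intervals
(`eventually_upperMass_le`). At time zero this follows from the L²(γ) bound, since γ{H ≥ h} is
exponentially small. It is propagated by Lyapunov functions V that increase with H: away from the
wells LV is negative, because H'' < 0 at the barrier and the drift dominates elsewhere. A first V,
with an ε-dependent exponent, controls {H ≥ 12} (`eventually_upperMass_twelve_le`); a second, with a
fixed exponent, contracts on the region between the wells and that set.

Reduced dynamics. Let g be continuous, odd and compactly supported, equal to ±1 near ±1. Solving Lf
= −k_ε g by two quadratures gives an odd f with f(1/2) = 1, provided that 1/k_ε is ε⁻² ∫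
plateau·e^{-H/ε²} times ∫₀^{1/2} e^{-(1-H)/ε²}. Then f and g are close near the wells
(`exists_eigen_error`), so by concentration ∫ρf ≈ ∫ρg, and d/dt ∫ρf = −k_ε ∫ρg closes into a
Gronwall argument. Laplace's method gives k_ε → k (`tendsto_effRate`). Hence ∫ρg →
e^{-kt}(2ρ⁰((0,∞)) − 1). Any bounded continuous φ is a combination of 1 and g up to a function
vanishing at both wells, so concentration yields the weak limit.

Test functions. V and f are only constant near infinity, and no decay of ∂ₓρ and no growth bound on
H' is available. The weak form is extended to them in `IsSolution.hasDerivAt_integral` by a cutoff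
whose error has a favourable sign, the drift being confining. -/

namespace Kramers

/-! ### Weak form of the equation for compactly supported test functions. -/

/-- The backward generator `τ_ε⁻¹ (f'' - ε⁻² H' f')`, for a function with derivatives `f₁`, `f₂`. -/
noncomputable def gen (H : ℝ → ℝ) (ε : ℝ) (f₁ f₂ : ℝ → ℝ) (x : ℝ) : ℝ :=
  (tau ε)⁻¹ * (f₂ x - (ε ^ 2)⁻¹ * deriv H x * f₁ x)

/-- `f` is bounded and twice continuously differentiable with derivatives `f₁`, `f₂`, and `f₁`
vanishes outside `[-R, R]`. -/
structure IsTestFn (f f₁ f₂ : ℝ → ℝ) (R : ℝ) : Prop where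
  deriv₁ : ∀ x, HasDerivAt f (f₁ x) x
  deriv₂ : ∀ x, HasDerivAt f₁ (f₂ x) x
  cont : Continuous f₂
  supp : ∀ x, R < |x| → f₁ x = 0
  bdd : ∃ F, ∀ x, |f x| ≤ F

theorem tau_pos {ε : ℝ} (hε : 0 < ε) : 0 < tau ε := by unfold tau; positivity

theorem continuous_of_hasDerivAt {f f₁ : ℝ → ℝ} (h : ∀ x, HasDerivAt f (f₁ x) x) : Continuous f :=
  continuous_iff_continuousAt.2 fun x => (h x).continuousAt

theorem deriv_eq_zero_outside {f f₁ : ℝ → ℝ} {R : ℝ} (h : ∀ x, HasDerivAt f (f₁ x) x)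
    (hf : ∀ x, R < |x| → f x = 0) (x : ℝ) (hx : R < |x|) : f₁ x = 0 := by
  have : f =ᶠ[𝓝 x] fun _ => 0 := by
    filter_upwards [continuous_abs.continuousAt.eventually (lt_mem_nhds hx)] with y hy
    exact hf y hy
  exact (h x).unique ((hasDerivAt_const x (0 : ℝ)).congr_of_eventuallyEq this)

theorem hasCompactSupport_of_outside {f : ℝ → ℝ} {R : ℝ} (hf : ∀ x, R < |x| → f x = 0) :
    HasCompactSupport f := by
  refine HasCompactSupport.intro (isCompact_Icc (a := -R) (b := R)) fun x hx => hf x ?_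
  by_contra h
  exact hx (abs_le.1 (not_lt.1 h))

namespace IsDoubleWell

variable {H : ℝ → ℝ} (hH : IsDoubleWell H)
include hH

theorem hasDerivAt (x : ℝ) : HasDerivAt H (deriv H x) x :=
  ((hH.smooth.differentiable (by simp)) x).hasDerivAt

theorem contDiff_deriv : ContDiff ℝ ∞ (deriv H) :=
  ((contDiff_infty_iff_deriv (𝕜 := ℝ)).1 hH.smooth).2

theorem hasDerivAt_deriv (x : ℝ) : HasDerivAt (deriv H) (deriv (deriv H) x) x :=
  ((hH.contDiff_deriv.differentiable (by simp)) x).hasDerivAt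

theorem continuous_deriv : Continuous (deriv H) := hH.contDiff_deriv.continuous

theorem continuous_deriv2 : Continuous (deriv (deriv H)) :=
  ((contDiff_infty_iff_deriv (𝕜 := ℝ)).1 hH.contDiff_deriv).2.continuous

theorem continuous_gen {ε : ℝ} {f₁ f₂ : ℝ → ℝ} (h₁ : Continuous f₁) (h₂ : Continuous f₂) :
    Continuous (gen H ε f₁ f₂) := by
  have := hH.continuous_deriv
  unfold gen
  fun_prop

end IsDoubleWell

namespace IsSolution

variable {H : ℝ → ℝ} {ε : ℝ} {ρ : ℝ → ProbDensity} {ρ₀ : ProbDensity}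
  (hρ : IsSolution H ε ρ ρ₀)
include hρ

theorem hasDerivAt_integral_time {q : ℝ → ℝ} {R : ℝ} (hq : Continuous q)
    (hsupp : ∀ x, R < |x| → q x = 0) {t : ℝ} (ht : 0 < t) :
    HasDerivAt (fun s => ∫ x, ρ s x * q x) (∫ x, deriv (fun s => ρ s x) t * q x) t := by
  have hK : IsCompact (Icc (t / 2) (2 * t) ×ˢ Icc (-R) R) := isCompact_Icc.prod isCompact_Icc
  have hcont : ContinuousOn (fun p : ℝ × ℝ => deriv (fun s => ρ s p.2) p.1 * q p.2)
      (Ioi 0 ×ˢ univ) := hρ.continuousOn_dt.mul (hq.comp continuous_snd).continuousOn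
  have hslice : ∀ s, 0 < s → Continuous fun x => deriv (fun s => ρ s x) s * q x := by
    intro s hs
    refine continuousOn_univ.1 (hcont.comp (f := fun x : ℝ => (s, x))
      (by fun_prop) fun x _ => ⟨hs, mem_univ _⟩)
  have hρc : ∀ s, 0 < s → Continuous (ρ s) := fun s hs => (hρ.contDiff_space s hs).continuous
  obtain ⟨B, hB⟩ := hK.exists_bound_of_continuousOn (E := ℝ)
    (hcont.mono (prod_mono (fun s hs => lt_of_lt_of_le (by linarith : (0 : ℝ) < t / 2) hs.1)
      (subset_univ _)))
  have hnhds : Icc (t / 2) (2 * t) ∈ 𝓝 t := Icc_mem_nhds (by linarith) (by linarith)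
  refine (hasDerivAt_integral_of_dominated_loc_of_deriv_le (μ := volume)
    (F := fun s x => ρ s x * q x) (F' := fun s x => deriv (fun s => ρ s x) s * q x)
    (bound := (Icc (-R) R).indicator fun _ => B) hnhds ?_ ?_ ?_ ?_ ?_ ?_).2
  · filter_upwards [lt_mem_nhds ht] with s hs
    exact ((hρc s hs).mul hq).aestronglyMeasurable
  · exact ((hρc t ht).mul hq).integrable_of_hasCompactSupport
      (hasCompactSupport_of_outside (R := R) fun x hx => by simp [hsupp x hx])
  · exact (hslice t ht).aestronglyMeasurable
  · refine ae_of_all _ fun x s hs => ?_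
    by_cases hx : x ∈ Icc (-R) R
    · rw [indicator_of_mem hx]
      exact hB (s, x) ⟨hs, hx⟩
    · rw [indicator_of_notMem hx, hsupp x, mul_zero, norm_zero]
      by_contra h
      exact hx (abs_le.1 (not_lt.1 h))
  · rw [integrable_indicator_iff measurableSet_Icc]
    exact integrableOn_const isCompact_Icc.measure_ne_top
  · refine ae_of_all _ fun x s hs => ?_
    exact ((hρ.differentiable_time s (lt_of_lt_of_le (by linarith) hs.1) x).hasDerivAt).mul_const _

/-- Two integrations by parts: the first moves the derivative off the flux, the second treats only
its diffusive part. Compact support of `q` removes all boundary terms. -/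
theorem integral_flux (hH : IsDoubleWell H) {q q₁ q₂ : ℝ → ℝ} {R : ℝ}
    (h₁ : ∀ x, HasDerivAt q (q₁ x) x) (h₂ : ∀ x, HasDerivAt q₁ (q₂ x) x) (hc : Continuous q₂)
    (hsupp : ∀ x, R < |x| → q x = 0) (hε : 0 < ε) {t : ℝ} (ht : 0 < t) :
    ∫ x, deriv (fun s => ρ s x) t * q x = ∫ x, ρ t x * gen H ε q₁ q₂ x := by
  have hs₁ := deriv_eq_zero_outside h₁ hsupp
  have hs₂ := deriv_eq_zero_outside h₂ hs₁
  have cq := continuous_of_hasDerivAt h₁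
  have cq₁ := continuous_of_hasDerivAt h₂
  have hC2 := hρ.contDiff_space t ht
  have hC1 : ContDiff ℝ 1 (deriv (ρ t)) :=
    ((contDiff_succ_iff_deriv (𝕜 := ℝ) (n := 1)).1 (by rw [one_add_one_eq_two]; exact hC2)).2.2
  have d0 : ∀ x, HasDerivAt (ρ t) (deriv (ρ t) x) x := fun x =>
    (hC2.differentiable (by simp) x).hasDerivAt
  have dflux : ∀ x, HasDerivAt (fun y => deriv (ρ t) y + (ε ^ 2)⁻¹ * ρ t y * deriv H y)
      (tau ε * deriv (fun s => ρ s x) t) x := by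
    intro x
    rw [hρ.equation t ht x]
    apply DifferentiableAt.hasDerivAt
    have e1 := hC1.differentiable (by simp) x
    have e2 := (d0 x).differentiableAt
    have e3 := (hH.hasDerivAt_deriv x).differentiableAt
    exact e1.add ((e2.const_mul _).mul e3)
  have cρ : Continuous (ρ t) := hC2.continuous
  have cρ1 : Continuous (deriv (ρ t)) := hC1.continuous
  have cH := hH.continuous_deriv
  have cdt : Continuous fun x => tau ε * deriv (fun s => ρ s x) t :=
    continuous_const.mul (continuousOn_univ.1 (hρ.continuousOn_dt.comp (f := fun x : ℝ => (t, x))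
      (by fun_prop) fun x _ => ⟨ht, mem_univ _⟩))
  have cfl := continuous_of_hasDerivAt dflux
  have int : ∀ {a b : ℝ → ℝ}, Continuous a → Continuous b → (∀ x, R < |x| → b x = 0) →
      Integrable (a * b) := fun ha hb h0 => (ha.mul hb).integrable_of_hasCompactSupport
        (hasCompactSupport_of_outside (R := R) fun x hx => by simp [h0 x hx])
  have ibp1 := integral_mul_deriv_eq_deriv_mul_of_integrable (fun x _ => dflux x)
    (fun x _ => h₁ x) (int cfl cq₁ hs₁) (int cdt cq hsupp) (int cfl cq hsupp)
  have ibp2 := integral_mul_deriv_eq_deriv_mul_of_integrable (fun x _ => d0 x)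
    (fun x _ => h₂ x) (int cρ hc hs₂) (int cρ1 cq₁ hs₁) (int cρ cq₁ hs₁)
  have e1 : ∫ x, deriv (fun s => ρ s x) t * q x
      = (tau ε)⁻¹ * ∫ x, tau ε * deriv (fun s => ρ s x) t * q x := by
    rw [← integral_const_mul]
    congr 1; ext x
    have := (tau_pos hε).ne'
    field_simp
  have e2 : ∫ x, (deriv (ρ t) x + (ε ^ 2)⁻¹ * ρ t x * deriv H x) * q₁ x
      = (∫ x, deriv (ρ t) x * q₁ x) + ∫ x, ((ε ^ 2)⁻¹ * ρ t x * deriv H x) * q₁ x := by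
    rw [← integral_add]
    · congr 1; ext x; ring
    · exact int cρ1 cq₁ hs₁
    · exact int (by fun_prop : Continuous fun x => (ε ^ 2)⁻¹ * ρ t x * deriv H x) cq₁ hs₁
  have e3 : ∫ x, ρ t x * gen H ε q₁ q₂ x
      = (tau ε)⁻¹ * ((∫ x, ρ t x * q₂ x) - ∫ x, ((ε ^ 2)⁻¹ * ρ t x * deriv H x) * q₁ x) := by
    rw [← integral_sub, ← integral_const_mul]
    · congr 1; ext x; unfold gen; ring
    · exact int cρ hc hs₂
    · exact int (by fun_prop : Continuous fun x => (ε ^ 2)⁻¹ * ρ t x * deriv H x) cq₁ hs₁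
  rw [e1, e3]
  rw [e2] at ibp1
  linear_combination (tau ε)⁻¹ * (ibp1 - ibp2)

theorem continuousOn_integral {q : ℝ → ℝ} {R : ℝ} (hq : Continuous q)
    (hsupp : ∀ x, R < |x| → q x = 0) :
    ContinuousOn (fun t => ∫ x, ρ t x * q x) (Ioi 0) := by
  refine continuousOn_integral_of_compact_support (f := fun t x => ρ t x * q x)
    (isCompact_Icc (a := -R) (b := R))
    (hρ.continuousOn.mul (hq.comp continuous_snd).continuousOn) fun t x _ hx => ?_
  rw [hsupp x, mul_zero]
  by_contra h
  exact hx (abs_le.1 (not_lt.1 h))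

end IsSolution

/-! ### Cutoffs and test functions that are constant near infinity. -/

/-- Used with `n = 1` and then `n = 0`: the cube of a positive part is C², which is why the cutoff
and the Lyapunov functions are built from cubes. -/
theorem hasDerivAt_max_zero_pow (n : ℕ) (y : ℝ) :
    HasDerivAt (fun y : ℝ => (max y 0) ^ (n + 2)) ((n + 2 : ℝ) * (max y 0) ^ (n + 1)) y := by
  rcases lt_trichotomy y 0 with h | h | h
  · have : (fun y : ℝ => (max y 0) ^ (n + 2)) =ᶠ[𝓝 y] fun _ => 0 := by
      filter_upwards [gt_mem_nhds h] with z hz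
      rw [max_eq_right hz.le]; simp
    rw [max_eq_right h.le]
    simpa using (hasDerivAt_const y (0 : ℝ)).congr_of_eventuallyEq this
  · subst h
    simp only [max_self, ne_eq, Nat.add_eq_zero_iff, one_ne_zero, and_false, not_false_eq_true,
      zero_pow, mul_zero]
    rw [hasDerivAt_iff_isLittleO]
    simp only [sub_zero, smul_zero, max_self, ne_eq, Nat.add_eq_zero_iff, OfNat.ofNat_ne_zero,
      and_false, not_false_eq_true, zero_pow]
    have h1 : (fun y : ℝ => (max y 0) ^ (n + 2)) =O[𝓝 0] fun y : ℝ => y ^ (n + 2) := by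
      refine Asymptotics.isBigO_of_le _ fun y => ?_
      rw [norm_pow, norm_pow]
      gcongr
      rw [Real.norm_eq_abs, Real.norm_eq_abs, abs_of_nonneg (le_max_right y 0)]
      exact max_le (le_abs_self y) (abs_nonneg y)
    exact h1.trans_isLittleO
      (by simpa using Asymptotics.isLittleO_pow_id (𝕜 := ℝ) (by omega : 1 < n + 2))
  · have : (fun y : ℝ => (max y 0) ^ (n + 2)) =ᶠ[𝓝 y] fun z => z ^ (n + 2) := by
      filter_upwards [lt_mem_nhds h] with z hz
      rw [max_eq_left hz.le]
    rw [max_eq_left h.le]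
    have := (hasDerivAt_pow (n + 2) y).congr_of_eventuallyEq this
    simpa using this

namespace ProbDensity

variable (ρ : ProbDensity)

theorem integral_law (φ : ℝ → ℝ) : ∫ x, φ x ∂(ρ.law : Measure ℝ) = ∫ x, ρ x * φ x := by
  change ∫ x, φ x ∂(volume.withDensity fun x => ENNReal.ofReal (ρ x)) = _
  rw [integral_withDensity_eq_integral_toReal_smul₀ ρ.integrable.aemeasurable.ennreal_ofReal
    (ae_of_all _ fun _ => ENNReal.ofReal_lt_top)]
  congr 1; ext x
  rw [ENNReal.toReal_ofReal (ρ.nonneg x), smul_eq_mul]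

theorem integrable_mul {φ : ℝ → ℝ} (hφ : Measurable φ) {F : ℝ} (hF : ∀ x, |φ x| ≤ F) :
    Integrable fun x => ρ x * φ x :=
  ρ.integrable.mul_bdd hφ.aestronglyMeasurable (ae_of_all _ hF)

theorem integral_const_mul (a : ℝ) : ∫ x, ρ x * a = a := by
  rw [MeasureTheory.integral_mul_const, ρ.integral_eq_one, one_mul]

theorem integral_mono {φ ψ : ℝ → ℝ} (hφ : Integrable fun x => ρ x * φ x)
    (hψ : Integrable fun x => ρ x * ψ x) (h : ∀ x, φ x ≤ ψ x) :
    ∫ x, ρ x * φ x ≤ ∫ x, ρ x * ψ x :=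
  MeasureTheory.integral_mono hφ hψ fun x => mul_le_mul_of_nonneg_left (h x) (ρ.nonneg x)

end ProbDensity

/-- A `C²` cutoff which is decreasing in `|x|`, vanishes for `R ≤ |x|` and tends to one. -/
noncomputable def cutoff (R x : ℝ) : ℝ := (max (1 - (x / R) ^ 2) 0) ^ 3

/-- First derivative of `cutoff`. -/
noncomputable def cutoff₁ (R x : ℝ) : ℝ := -(6 * x / R ^ 2) * (max (1 - (x / R) ^ 2) 0) ^ 2

/-- Second derivative of `cutoff`. -/
noncomputable def cutoff₂ (R x : ℝ) : ℝ :=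
  24 * x ^ 2 / R ^ 4 * max (1 - (x / R) ^ 2) 0 - 6 / R ^ 2 * (max (1 - (x / R) ^ 2) 0) ^ 2

section cutoff

variable {R : ℝ}

theorem hasDerivAt_one_sub_sq (R x : ℝ) :
    HasDerivAt (fun x : ℝ => 1 - (x / R) ^ 2) (-(2 * x / R ^ 2)) x := by
  have := (((hasDerivAt_id x).div_const R).pow 2).const_sub 1
  refine this.congr_deriv ?_
  simp only [id, Nat.cast_ofNat, Nat.add_one_sub_one, pow_one]
  ring

theorem hasDerivAt_cutoff (R x : ℝ) : HasDerivAt (cutoff R) (cutoff₁ R x) x := by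
  have := (hasDerivAt_max_zero_pow 1 (1 - (x / R) ^ 2)).comp x (hasDerivAt_one_sub_sq R x)
  refine this.congr_deriv ?_
  unfold cutoff₁
  push_cast
  ring

theorem hasDerivAt_cutoff₁ (R x : ℝ) : HasDerivAt (cutoff₁ R) (cutoff₂ R x) x := by
  have := (hasDerivAt_max_zero_pow 0 (1 - (x / R) ^ 2)).comp x (hasDerivAt_one_sub_sq R x)
  have h := (((hasDerivAt_id x).const_mul 6).div_const (R ^ 2)).neg.mul this
  refine h.congr_deriv ?_
  unfold cutoff₂
  simp only [id, Function.comp, Pi.neg_apply]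
  push_cast
  ring

theorem continuous_cutoff₂ (R : ℝ) : Continuous (cutoff₂ R) := by unfold cutoff₂; fun_prop

theorem cutoff_base_le_one (R x : ℝ) : max (1 - (x / R) ^ 2) 0 ≤ 1 :=
  max_le (by nlinarith [sq_nonneg (x / R)]) zero_le_one

theorem cutoff_nonneg (R x : ℝ) : 0 ≤ cutoff R x := pow_nonneg (le_max_right _ _) _

theorem cutoff_le_one (R x : ℝ) : cutoff R x ≤ 1 :=
  pow_le_one₀ (le_max_right _ _) (cutoff_base_le_one R x)

theorem cutoff_eq_zero (hR : 0 < R) {x : ℝ} (hx : R < |x|) : cutoff R x = 0 := by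
  have : 1 < (x / R) ^ 2 := by
    rw [← sq_abs, abs_div, abs_of_pos hR]
    exact one_lt_pow₀ ((one_lt_div hR).2 hx) two_ne_zero
  unfold cutoff
  rw [max_eq_right (by linarith)]
  norm_num

theorem one_sub_cutoff_le (R x : ℝ) : 1 - cutoff R x ≤ 3 * x ^ 2 / R ^ 2 := by
  have h0 : 0 ≤ max (1 - (x / R) ^ 2) 0 := le_max_right _ _
  have h2 : 1 - (x / R) ^ 2 ≤ max (1 - (x / R) ^ 2) 0 := le_max_left _ _
  have e : 3 * x ^ 2 / R ^ 2 = 3 * (x / R) ^ 2 := by rw [div_pow]; ring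
  rw [e]
  unfold cutoff
  set m := max (1 - (x / R) ^ 2) 0
  -- Bernoulli's inequality: m³ ≥ 1 + 3(m − 1).
  have h3 := one_add_mul_le_pow (a := m - 1) (by linarith) 3
  push_cast at h3
  have : (1 + (m - 1)) ^ 3 = m ^ 3 := by ring
  linarith

theorem abs_cutoff₁_le (R x : ℝ) : |cutoff₁ R x| ≤ 6 * |x| / R ^ 2 := by
  unfold cutoff₁
  have h0 : 0 ≤ max (1 - (x / R) ^ 2) 0 := le_max_right _ _
  rw [abs_mul, abs_neg, abs_div, abs_mul, abs_of_nonneg (sq_nonneg R),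
    abs_of_nonneg (pow_nonneg h0 2), abs_of_pos (by norm_num : (0 : ℝ) < 6)]
  exact mul_le_of_le_one_right (by positivity) (pow_le_one₀ h0 (cutoff_base_le_one R x))

theorem cutoff₂_ge (R x : ℝ) : -(6 / R ^ 2) ≤ cutoff₂ R x := by
  unfold cutoff₂
  have h0 : 0 ≤ max (1 - (x / R) ^ 2) 0 := le_max_right _ _
  have h1 : 6 / R ^ 2 * (max (1 - (x / R) ^ 2) 0) ^ 2 ≤ 6 / R ^ 2 :=
    mul_le_of_le_one_right (by positivity) (pow_le_one₀ h0 (cutoff_base_le_one R x))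
  have h2 : 0 ≤ 24 * x ^ 2 / R ^ 4 * max (1 - (x / R) ^ 2) 0 := by positivity
  linarith

theorem tendsto_cutoff (x : ℝ) : Tendsto (fun n : ℕ => cutoff n x) atTop (𝓝 1) := by
  have h : Tendsto (fun n : ℕ => x / (n : ℝ)) atTop (𝓝 0) := tendsto_const_div_atTop_nhds_zero_nat x
  have c : Continuous fun y : ℝ => (max (1 - y ^ 2) 0) ^ 3 := by fun_prop
  have := (c.tendsto 0).comp h
  simp only [ne_eq, OfNat.ofNat_ne_zero, not_false_eq_true, zero_pow, sub_zero, zero_le_one,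
    sup_of_le_left, one_pow] at this
  exact this

end cutoff

theorem exists_bound_of_outside {f : ℝ → ℝ} {R : ℝ} (hf : Continuous f)
    (h : ∀ x, R < |x| → f x = 0) : ∃ K, 0 ≤ K ∧ ∀ x, |f x| ≤ K := by
  obtain ⟨K, hK⟩ := (hasCompactSupport_of_outside h).exists_bound_of_continuous hf
  exact ⟨K, (norm_nonneg _).trans (hK 0), hK⟩

namespace IsTestFn

variable {f f₁ f₂ : ℝ → ℝ} {R : ℝ} (hf : IsTestFn f f₁ f₂ R)
include hf

theorem continuous : Continuous f := continuous_of_hasDerivAt hf.deriv₁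

theorem continuous₁ : Continuous f₁ := continuous_of_hasDerivAt hf.deriv₂

theorem supp₂ (x : ℝ) (hx : R < |x|) : f₂ x = 0 := deriv_eq_zero_outside hf.deriv₂ hf.supp x hx

theorem gen_supp (H : ℝ → ℝ) (ε : ℝ) (x : ℝ) (hx : R < |x|) : gen H ε f₁ f₂ x = 0 := by
  simp [gen, hf.supp x hx, hf.supp₂ x hx]

theorem const_add (F : ℝ) : IsTestFn (fun x => F + f x) f₁ f₂ R where
  deriv₁ x := (hf.deriv₁ x).const_add F
  deriv₂ := hf.deriv₂
  cont := hf.cont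
  supp := hf.supp
  bdd := by
    obtain ⟨B, hB⟩ := hf.bdd
    exact ⟨|F| + B, fun x => (abs_add_le _ _).trans (by linarith [hB x])⟩

theorem neg : IsTestFn (fun x => -f x) (fun x => -f₁ x) (fun x => -f₂ x) R where
  deriv₁ x := (hf.deriv₁ x).neg
  deriv₂ x := (hf.deriv₂ x).neg
  cont := hf.cont.neg
  supp x hx := by simp [hf.supp x hx]
  bdd := by simpa using hf.bdd

end IsTestFn

/-- Cutting off a nonnegative test function decreases the generator by at most `O(R⁻²)`. -/
theorem gen_mul_cutoff_ge {H : ℝ → ℝ} (hH : IsDoubleWell H) {ε : ℝ} (hε : 0 < ε)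
    {p p₁ p₂ : ℝ → ℝ} {a : ℝ} (hp : IsTestFn p p₁ p₂ a) (hp0 : ∀ x, 0 ≤ p x) :
    ∃ K, ∀ R, 0 < R → ∀ x, gen H ε p₁ p₂ x - K / R ^ 2 ≤
      gen H ε (fun x => p₁ x * cutoff R x + p x * cutoff₁ R x)
        (fun x => p₂ x * cutoff R x + 2 * p₁ x * cutoff₁ R x + p x * cutoff₂ R x) x := by
  have cg := hH.continuous_gen (ε := ε) hp.continuous₁ hp.cont
  have c1 := hp.continuous₁
  obtain ⟨K₁, -, hK₁⟩ := exists_bound_of_outside (f := fun x => x ^ 2 * gen H ε p₁ p₂ x) (R := a)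
    (by fun_prop) fun x hx => by simp [hp.gen_supp H ε x hx]
  obtain ⟨K₂, -, hK₂⟩ := exists_bound_of_outside (f := fun x => x * p₁ x) (R := a)
    (by fun_prop) fun x hx => by simp [hp.supp x hx]
  have cH := hH.continuous_deriv
  obtain ⟨K₃, hK₃⟩ := (isCompact_Icc (a := (-1 : ℝ)) (b := 1)).exists_bound_of_continuousOn
    (f := fun x => x * deriv H x) (by fun_prop)
  have hK₃0 : 0 ≤ K₃ := (norm_nonneg _).trans (hK₃ 0 (by norm_num))
  -- Outside [-1, 1] the drift is confining, so x H' is bounded below whatever the growth of H'.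
  have hlow : ∀ x, -K₃ ≤ x * deriv H x := by
    intro x
    rcases le_or_gt |x| 1 with h | h
    · exact (abs_le.1 (hK₃ x (abs_le.1 h))).1
    · linarith [hH.deriv_outer x h]
  obtain ⟨F, hF⟩ := hp.bdd
  have hF0 : 0 ≤ F := (abs_nonneg _).trans (hF 0)
  have hτ := inv_pos.2 (tau_pos hε)
  refine ⟨3 * K₁ + (tau ε)⁻¹ * (12 * K₂ + F * (6 + (ε ^ 2)⁻¹ * (6 * K₃))), fun R hR x => ?_⟩
  have hR2 : 0 < (R ^ 2)⁻¹ := by positivity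
  -- Product rule for the generator. Each of the remaining terms is bounded below by a multiple of
  -- −R⁻²; the drift term −H'χ' is a nonnegative multiple of x H'.
  have e : gen H ε (fun x => p₁ x * cutoff R x + p x * cutoff₁ R x)
        (fun x => p₂ x * cutoff R x + 2 * p₁ x * cutoff₁ R x + p x * cutoff₂ R x) x =
      gen H ε p₁ p₂ x - (1 - cutoff R x) * gen H ε p₁ p₂ x + (tau ε)⁻¹ * (2 * (p₁ x * cutoff₁ R x)
        + p x * (cutoff₂ R x + (ε ^ 2)⁻¹ * (-(deriv H x * cutoff₁ R x)))) := by
    unfold gen; ring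
  rw [e]
  have t1 : (1 - cutoff R x) * gen H ε p₁ p₂ x ≤ 3 * K₁ * (R ^ 2)⁻¹ := by
    calc (1 - cutoff R x) * gen H ε p₁ p₂ x
        ≤ (1 - cutoff R x) * |gen H ε p₁ p₂ x| :=
          mul_le_mul_of_nonneg_left (le_abs_self _) (by linarith [cutoff_le_one R x])
      _ ≤ 3 * x ^ 2 / R ^ 2 * |gen H ε p₁ p₂ x| :=
          mul_le_mul_of_nonneg_right (one_sub_cutoff_le R x) (abs_nonneg _)
      _ = 3 * |x ^ 2 * gen H ε p₁ p₂ x| * (R ^ 2)⁻¹ := by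
          rw [abs_mul, abs_of_nonneg (sq_nonneg x)]; ring
      _ ≤ _ := by have := hK₁ x; gcongr
  have t2 : -(6 * K₂ * (R ^ 2)⁻¹) ≤ p₁ x * cutoff₁ R x := by
    refine (abs_le.1 ?_).1
    calc |p₁ x * cutoff₁ R x| ≤ |p₁ x| * (6 * |x| / R ^ 2) := by
          rw [abs_mul]; exact mul_le_mul_of_nonneg_left (abs_cutoff₁_le R x) (abs_nonneg _)
      _ = 6 * |x * p₁ x| * (R ^ 2)⁻¹ := by rw [abs_mul]; ring
      _ ≤ _ := by have := hK₂ x; gcongr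
  have t3 : -(6 * K₃ * (R ^ 2)⁻¹) ≤ -(deriv H x * cutoff₁ R x) := by
    have hm : 0 ≤ max (1 - (x / R) ^ 2) 0 := le_max_right _ _
    have hm1 := cutoff_base_le_one R x
    have e3 : -(deriv H x * cutoff₁ R x) =
        6 * (R ^ 2)⁻¹ * ((max (1 - (x / R) ^ 2) 0) ^ 2 * (x * deriv H x)) := by
      unfold cutoff₁; ring
    have hm2 := pow_le_one₀ hm hm1 (n := 2)
    have : -K₃ ≤ (max (1 - (x / R) ^ 2) 0) ^ 2 * (x * deriv H x) := by
      nlinarith [hlow x, pow_nonneg hm 2]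
    rw [e3]
    nlinarith
  have t4 : -(F * ((6 + (ε ^ 2)⁻¹ * (6 * K₃)) * (R ^ 2)⁻¹)) ≤
      p x * (cutoff₂ R x + (ε ^ 2)⁻¹ * (-(deriv H x * cutoff₁ R x))) := by
    have hε2 : 0 < (ε ^ 2)⁻¹ := by positivity
    have a1 : -((6 + (ε ^ 2)⁻¹ * (6 * K₃)) * (R ^ 2)⁻¹) ≤
        cutoff₂ R x + (ε ^ 2)⁻¹ * (-(deriv H x * cutoff₁ R x)) := by
      have b1 := cutoff₂_ge R x
      have b2 := mul_le_mul_of_nonneg_left t3 hε2.le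
      rw [div_eq_mul_inv] at b1
      linarith
    have a2 : p x ≤ F := (le_abs_self _).trans (hF x)
    have a3 : 0 ≤ (6 + (ε ^ 2)⁻¹ * (6 * K₃)) * (R ^ 2)⁻¹ := by positivity
    nlinarith [hp0 x, mul_le_mul_of_nonneg_left a1 (hp0 x)]
  have t5 := mul_le_mul_of_nonneg_left (add_le_add (mul_le_mul_of_nonneg_left t2 zero_le_two) t4)
    hτ.le
  rw [div_eq_mul_inv]
  linarith

namespace IsSolution

variable {H : ℝ → ℝ} {ε : ℝ} {ρ : ℝ → ProbDensity} {ρ₀ : ProbDensity}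
  (hρ : IsSolution H ε ρ ρ₀)
include hρ

/-- The compactly supported weak form is applied to p times a cutoff of radius n, and n → ∞. Only an
inequality survives, since the cutoff error is controlled from one side; this is where p ≥ 0 enters.
-/
theorem integral_gen_le {p p₁ p₂ : ℝ → ℝ} {a : ℝ} (hH : IsDoubleWell H) (hε : 0 < ε)
    (hp : IsTestFn p p₁ p₂ a) (hp0 : ∀ x, 0 ≤ p x) {s t : ℝ} (hs : 0 < s) (hst : s ≤ t) :
    ∫ r in s..t, ∫ x, ρ r x * gen H ε p₁ p₂ x ≤ (∫ x, ρ t x * p x) - ∫ x, ρ s x * p x := by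
  obtain ⟨K, hK⟩ := gen_mul_cutoff_ge hH hε hp hp0
  obtain ⟨F, hF⟩ := hp.bdd
  have cg := hH.continuous_gen (ε := ε) hp.continuous₁ hp.cont
  have hsub : uIcc s t ⊆ Ioi 0 := by
    rw [uIcc_of_le hst]; exact fun r hr => lt_of_lt_of_le hs hr.1
  have hlim : ∀ r, Tendsto (fun n : ℕ => ∫ x, ρ r x * (p x * cutoff n x)) atTop
      (𝓝 (∫ x, ρ r x * p x)) := by
    intro r
    refine tendsto_integral_of_dominated_convergence (fun x => ρ r x * F) (fun n => ?_)
      ((ρ r).integrable.mul_const F) (fun n => ae_of_all _ fun x => ?_) (ae_of_all _ fun x => ?_)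
    · exact (ρ r).integrable.aestronglyMeasurable.mul (hp.continuous.mul
        (continuous_of_hasDerivAt (hasDerivAt_cutoff n))).aestronglyMeasurable
    · rw [norm_mul, Real.norm_eq_abs, abs_of_nonneg ((ρ r).nonneg x), norm_mul]
      refine mul_le_mul_of_nonneg_left ?_ ((ρ r).nonneg x)
      rw [Real.norm_eq_abs, Real.norm_eq_abs, abs_of_nonneg (cutoff_nonneg n x)]
      exact (mul_le_of_le_one_right (abs_nonneg _) (cutoff_le_one n x)).trans (hF x)
    · simpa using ((tendsto_cutoff x).const_mul (p x)).const_mul (ρ r x)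
  have hK0 : Tendsto (fun n : ℕ => (∫ r in s..t, ∫ x, ρ r x * gen H ε p₁ p₂ x)
      - (t - s) * (K / (n : ℝ) ^ 2)) atTop (𝓝 (∫ r in s..t, ∫ x, ρ r x * gen H ε p₁ p₂ x)) := by
    have h2 : Tendsto (fun n : ℕ => K / (n : ℝ) ^ 2) atTop (𝓝 0) :=
      tendsto_const_nhds.div_atTop
        ((tendsto_pow_atTop two_ne_zero).comp tendsto_natCast_atTop_atTop)
    simpa using (h2.const_mul (t - s)).const_sub (∫ r in s..t, ∫ x, ρ r x * gen H ε p₁ p₂ x)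
  refine le_of_tendsto_of_tendsto hK0 ((hlim t).sub (hlim s)) ?_
  filter_upwards [eventually_gt_atTop 0] with n hn
  have hn' : (0 : ℝ) < n := Nat.cast_pos.2 hn
  have d1 : ∀ x, HasDerivAt (fun x => p x * cutoff n x)
      (p₁ x * cutoff n x + p x * cutoff₁ n x) x := fun x =>
    (hp.deriv₁ x).mul (hasDerivAt_cutoff n x)
  have d2 : ∀ x, HasDerivAt (fun x => p₁ x * cutoff n x + p x * cutoff₁ n x)
      (p₂ x * cutoff n x + 2 * p₁ x * cutoff₁ n x + p x * cutoff₂ n x) x := fun x =>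
    (((hp.deriv₂ x).mul (hasDerivAt_cutoff n x)).add
      ((hp.deriv₁ x).mul (hasDerivAt_cutoff₁ n x))).congr_deriv (by ring)
  have c0 := continuous_of_hasDerivAt (hasDerivAt_cutoff n)
  have c1 := continuous_of_hasDerivAt (hasDerivAt_cutoff₁ n)
  have c2 := continuous_cutoff₂ n
  have cp := hp.continuous
  have cp1 := hp.continuous₁
  have cp2 := hp.cont
  have cq2 : Continuous fun x => p₂ x * cutoff n x + 2 * p₁ x * cutoff₁ n x + p x * cutoff₂ n x := by
    fun_prop
  have hs0 : ∀ x, (n : ℝ) < |x| → p x * cutoff n x = 0 := fun x hx => by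
    rw [cutoff_eq_zero hn' hx, mul_zero]
  have hs1 := deriv_eq_zero_outside d1 hs0
  have hs2 := deriv_eq_zero_outside d2 hs1
  set q₁ := fun x => p₁ x * cutoff n x + p x * cutoff₁ n x
  set q₂ := fun x => p₂ x * cutoff n x + 2 * p₁ x * cutoff₁ n x + p x * cutoff₂ n x
  have cgq := hH.continuous_gen (ε := ε) (continuous_of_hasDerivAt d2) cq2
  have hgq : ∀ x, (n : ℝ) < |x| → gen H ε q₁ q₂ x = 0 := fun x hx => by
    have e1 : q₁ x = 0 := hs1 x hx
    have e2 : q₂ x = 0 := hs2 x hx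
    simp [gen, e1, e2]
  have hcont := hρ.continuousOn_integral cgq hgq
  have hcontp := hρ.continuousOn_integral cg (hp.gen_supp H ε)
  have hd : ∀ r ∈ uIcc s t, HasDerivAt (fun r => ∫ x, ρ r x * (p x * cutoff n x))
      (∫ x, ρ r x * gen H ε q₁ q₂ x) r := fun r hr => by
    rw [← hρ.integral_flux hH d1 d2 cq2 hs0 hε (hsub hr)]
    exact hρ.hasDerivAt_integral_time (cp.mul c0) hs0 (hsub hr)
  rw [← intervalIntegral.integral_eq_sub_of_hasDerivAt hd
    (hcont.mono hsub).intervalIntegrable, ← smul_eq_mul (t - s), ← intervalIntegral.integral_const,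
    ← intervalIntegral.integral_sub (hcontp.mono hsub).intervalIntegrable
      intervalIntegrable_const]
  refine intervalIntegral.integral_mono_on hst
    (((hcontp.mono hsub).intervalIntegrable).sub intervalIntegrable_const)
    (hcont.mono hsub).intervalIntegrable fun r hr => ?_
  obtain ⟨B₁, -, hB₁⟩ := exists_bound_of_outside cg (hp.gen_supp H ε)
  obtain ⟨B₂, -, hB₂⟩ := exists_bound_of_outside cgq hgq
  have i1 := (ρ r).integrable_mul cg.measurable hB₁
  have i2 := (ρ r).integrable_mul cgq.measurable hB₂
  have i3 := (ρ r).integrable.mul_const (K / (n : ℝ) ^ 2)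
  have : (∫ x, ρ r x * gen H ε p₁ p₂ x) - K / (n : ℝ) ^ 2 =
      ∫ x, ρ r x * (gen H ε p₁ p₂ x - K / (n : ℝ) ^ 2) := by
    simp_rw [mul_sub]
    rw [integral_sub i1 i3, (ρ r).integral_const_mul]
  rw [this]
  refine (ρ r).integral_mono ?_ i2 (hK n hn')
  simp only [mul_sub]
  exact i1.sub i3

/-- The weak form of the equation against test functions that are constant near infinity. -/
theorem hasDerivAt_integral {f f₁ f₂ : ℝ → ℝ} {a : ℝ} (hH : IsDoubleWell H) (hε : 0 < ε)
    (hf : IsTestFn f f₁ f₂ a) {t : ℝ} (ht : 0 < t) :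
    HasDerivAt (fun t => ∫ x, ρ t x * f x) (∫ x, ρ t x * gen H ε f₁ f₂ x) t := by
  obtain ⟨F, hF⟩ := hf.bdd
  -- The one-sided inequality for the nonnegative functions F + f and F − f gives both directions;
  -- the constants cancel because the total mass is one.
  have key : ∀ s t, 0 < s → s ≤ t →
      ∫ r in s..t, ∫ x, ρ r x * gen H ε f₁ f₂ x = (∫ x, ρ t x * f x) - ∫ x, ρ s x * f x := by
    intro s t hs hst
    have hi : ∀ r, Integrable fun x => ρ r x * f x := fun r =>
      (ρ r).integrable_mul hf.continuous.measurable hF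
    have hF' : ∀ r, Integrable fun x => ρ r x * F := fun r => (ρ r).integrable.mul_const F
    have e1 : ∀ r, ∫ x, ρ r x * (F + f x) = F + ∫ x, ρ r x * f x := fun r => by
      simp_rw [mul_add]
      rw [integral_add (hF' r) (hi r), (ρ r).integral_const_mul]
    have e2 : ∀ r, ∫ x, ρ r x * (F + -f x) = F - ∫ x, ρ r x * f x := fun r => by
      simp_rw [mul_add, mul_neg, ← sub_eq_add_neg]
      rw [integral_sub (hF' r) (hi r), (ρ r).integral_const_mul]
    have e3 : ∀ r, ∫ x, ρ r x * gen H ε (fun x => -f₁ x) (fun x => -f₂ x) x =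
        -∫ x, ρ r x * gen H ε f₁ f₂ x := fun r => by
      rw [← integral_neg]; congr 1; ext x; unfold gen; ring
    have h1 := hρ.integral_gen_le hH hε (hf.const_add F)
      (fun x => by linarith [neg_le_of_abs_le (hF x)]) hs hst
    have h2 := hρ.integral_gen_le hH hε (hf.neg.const_add F)
      (fun x => by linarith [le_of_abs_le (hF x)]) hs hst
    rw [e1, e1] at h1
    rw [e2, e2] at h2
    simp_rw [e3] at h2
    rw [intervalIntegral.integral_neg] at h2
    linarith
  have hcont := hρ.continuousOn_integral (hH.continuous_gen (ε := ε) hf.continuous₁ hf.cont)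
    (hf.gen_supp H ε)
  have hsub : uIcc (t / 2) t ⊆ Ioi 0 := by
    rw [uIcc_of_le (by linarith)]; exact fun r hr => lt_of_lt_of_le (half_pos ht) hr.1
  have hd := (intervalIntegral.integral_hasDerivAt_right (hcont.mono hsub).intervalIntegrable
    (hcont.stronglyMeasurableAtFilter isOpen_Ioi t ht)
    (hcont.continuousAt (Ioi_mem_nhds ht))).const_add (∫ x, ρ (t / 2) x * f x)
  refine hd.congr_of_eventuallyEq ?_
  filter_upwards [lt_mem_nhds (half_lt_self ht)] with s hs
  rw [key _ _ (half_pos ht) hs.le]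
  ring

theorem tendsto_integral {f : ℝ → ℝ} {F : ℝ} (hf : Continuous f) (hF : ∀ x, |f x| ≤ F) :
    Tendsto (fun t => ∫ x, ρ t x * f x) (𝓝[>] 0) (𝓝 (∫ x, ρ₀ x * f x)) := by
  have := ProbabilityMeasure.tendsto_iff_forall_integral_tendsto.1 hρ.attained
    (BoundedContinuousFunction.ofNormedAddCommGroup f hf F hF)
  simpa [ProbDensity.integral_law] using this

end IsSolution

/-! ### Differential inequalities on (0, T]. -/

/-- The initial value enters only as a limit at 0⁺, matching the weak sense in which solutions
attain their data. -/
theorem le_of_hasDerivAt_nonpos {z z' : ℝ → ℝ} {z₀ T : ℝ} (hT : 0 < T)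
    (hz : ∀ t, 0 < t → HasDerivAt z (z' t) t) (h0 : Tendsto z (𝓝[>] 0) (𝓝 z₀))
    (h : ∀ t, 0 < t → t < T → z' t ≤ 0) : z T ≤ z₀ := by
  have anti : AntitoneOn z (Ioc 0 T) := by
    refine antitoneOn_of_deriv_nonpos (convex_Ioc 0 T)
      (fun t ht => (hz t ht.1).continuousAt.continuousWithinAt) ?_ ?_
    · rw [interior_Ioc]
      exact fun t ht => (hz t ht.1).differentiableAt.differentiableWithinAt
    · rw [interior_Ioc]
      intro t ht
      rw [(hz t ht.1).deriv]
      exact h t ht.1 ht.2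
  refine ge_of_tendsto h0 ?_
  filter_upwards [Ioc_mem_nhdsGT hT] with s hs
  exact anti hs ⟨hT, le_rfl⟩ hs.2

/-- Gronwall's inequality, by the integrating factor e^{Λt}. -/
theorem exp_mul_sub_le {y y' : ℝ → ℝ} {y₀ Λ B T : ℝ} (hT : 0 < T)
    (hy : ∀ t, 0 < t → HasDerivAt y (y' t) t) (h0 : Tendsto y (𝓝[>] 0) (𝓝 y₀))
    (h : ∀ t, 0 < t → t < T → y' t ≤ Λ * (B - y t)) : Real.exp (Λ * T) * (y T - B) ≤ y₀ - B := by
  refine le_of_hasDerivAt_nonpos (z := fun t => Real.exp (Λ * t) * (y t - B))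
    (z' := fun t => Real.exp (Λ * t) * Λ * (y t - B) + Real.exp (Λ * t) * y' t) hT ?_ ?_ ?_
  · intro t ht
    exact ((((hasDerivAt_id t).const_mul Λ).exp).mul ((hy t ht).sub_const B)).congr_deriv
      (by simp)
  · have c : Continuous fun t : ℝ => Real.exp (Λ * t) := by fun_prop
    have := ((c.tendsto 0).mono_left nhdsWithin_le_nhds).mul (h0.sub_const B)
    simpa using this
  · intro t ht htT
    have := mul_le_mul_of_nonneg_left (h t ht htT) (Real.exp_nonneg (Λ * t))
    linarith

theorem tendsto_inv_sq_atTop : Tendsto (fun ε : ℝ => (ε ^ 2)⁻¹) (𝓝[>] 0) atTop := by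
  simp_rw [← inv_pow]
  exact (tendsto_pow_atTop two_ne_zero).comp tendsto_inv_nhdsGT_zero

theorem tendsto_exp_neg_mul_inv_sq {a : ℝ} (ha : 0 < a) :
    Tendsto (fun ε : ℝ => Real.exp (-(a * (ε ^ 2)⁻¹))) (𝓝[>] 0) (𝓝 0) :=
  Real.tendsto_exp_neg_atTop_nhds_zero.comp (tendsto_inv_sq_atTop.const_mul_atTop ha)

/-! ### Geometry of the double well. -/

namespace IsDoubleWell

variable {H : ℝ → ℝ} (hH : IsDoubleWell H)
include hH

theorem continuous : Continuous H := hH.smooth.continuous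

theorem deriv_pos {x : ℝ} (hx : 1 < x) : 0 < deriv H x := by
  have := hH.deriv_outer x (by rwa [abs_of_pos (by linarith)])
  exact pos_of_mul_pos_right this (by linarith)

theorem deriv_neg_inner {x : ℝ} (h0 : 0 < x) (h1 : x < 1) : deriv H x < 0 := by
  have := hH.deriv_inner x (by rwa [abs_of_pos h0]) (by rwa [abs_of_pos h0])
  exact neg_of_mul_neg_right this h0.le

theorem strictMonoOn : StrictMonoOn H (Ici 1) :=
  strictMonoOn_of_deriv_pos (convex_Ici 1) hH.continuous.continuousOn
    (by rw [interior_Ici]; exact fun x hx => hH.deriv_pos hx)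

theorem strictAntiOn : StrictAntiOn H (Icc 0 1) :=
  strictAntiOn_of_deriv_neg (convex_Icc 0 1) hH.continuous.continuousOn
    (by rw [interior_Icc]; exact fun x hx => hH.deriv_neg_inner hx.1 hx.2)

theorem apply_abs (x : ℝ) : H |x| = H x := by
  rcases abs_choice x with h | h <;> rw [h]
  exact hH.even x

theorem pos_of_nonneg {x : ℝ} (h0 : 0 ≤ x) (h1 : x ≠ 1) : 0 < H x := by
  rw [← hH.well.1]
  rcases lt_or_gt_of_ne h1 with h | h
  · exact hH.strictAntiOn ⟨h0, h.le⟩ (by simp) h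
  · exact hH.strictMonoOn (by simp) (mem_Ici.2 h.le) h

theorem deriv_eq_zero {x : ℝ} (hx : deriv H x = 0) : x = 0 ∨ |x| = 1 := by
  by_contra! h
  rcases lt_or_gt_of_ne h.2 with h' | h'
  · have := hH.deriv_inner x (abs_pos.2 h.1) h'
    simp [hx] at this
  · have := hH.deriv_outer x h'
    simp [hx] at this

theorem eq_zero_of_abs_eq_one {x : ℝ} (hx : |x| = 1) : H x = 0 := by
  rw [← hH.apply_abs, hx, hH.well.1]

/-- Coercivity comes from the partition function: H increases on [1, ∞), so if it took values at
most M arbitrarily far out it would be at most M on all of [1, ∞), and e^{-H/ε²} would not be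
integrable. -/
theorem exists_outside {ε : ℝ} (hZ : Integrable fun x : ℝ => Real.exp (-H x / ε ^ 2)) (M : ℝ) :
    ∃ R, ∀ x, R < |x| → M < H x := by
  by_contra! hcon
  have hle : ∀ x, 1 ≤ x → H x ≤ M := by
    intro x hx
    obtain ⟨y, hy, hyM⟩ := hcon x
    rw [← hH.apply_abs] at hyM
    exact (hH.strictMonoOn.monotoneOn (mem_Ici.2 hx) (mem_Ici.2 (hx.trans hy.le)) hy.le).trans hyM
  have hi : IntegrableOn (fun _ : ℝ => Real.exp (-M / ε ^ 2)) (Ici 1) := by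
    refine Integrable.mono' (hZ.integrableOn (s := Ici 1)) (by fun_prop) ?_
    filter_upwards [ae_restrict_mem measurableSet_Ici] with x hx
    rw [Real.norm_eq_abs, abs_of_pos (Real.exp_pos _)]
    have := hle x hx
    gcongr
  rw [integrableOn_const_iff (by simp)] at hi
  rcases hi with h | h
  · simp at h
  · simp at h

/-- Away from the wells, `H''` is negative wherever `H'` vanishes; hence `H'' - N H'² / 2` is
bounded away from zero there for large `N`. -/
theorem exists_bracket_bound {ε : ℝ} (hZ : Integrable fun x : ℝ => Real.exp (-H x / ε ^ 2))
    (M : ℝ) {h : ℝ} (hh : 0 < h) :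
    ∃ c > 0, ∃ K, 0 ≤ K ∧ ∃ N₀, ∀ N, N₀ ≤ N → 0 ≤ N → ∀ x, H x ≤ M →
      deriv (deriv H) x - N / 2 * deriv H x ^ 2 ≤ K ∧
      (h ≤ H x → deriv (deriv H) x - N / 2 * deriv H x ^ 2 ≤ -c) := by
  obtain ⟨R, hR⟩ := hH.exists_outside hZ M
  have hc2 := hH.continuous_deriv2
  have hc1 := hH.continuous_deriv
  have hc0 := hH.continuous
  obtain ⟨K, hK⟩ := (isCompact_Icc (a := -R) (b := R)).exists_bound_of_continuousOn
    (f := deriv (deriv H)) hc2.continuousOn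
  have hin : ∀ x, H x ≤ M → x ∈ Icc (-R) R := fun x hx => by
    by_contra hx'
    exact absurd (hR x (not_le.1 fun h => hx' (abs_le.1 h))) (not_lt.2 hx)
  have h00 := hH.deriv2_barrier
  -- Half of |H''(0)|, so that H''(0) < −c and the barrier point is excluded from the compact set
  -- below.
  set c := -deriv (deriv H) 0 / 2 with hc
  have hcpos : 0 < c := by linarith
  -- This set contains no critical point: 0 is excluded by H'' ≥ −c and ±1 by H ≥ h > 0. So H'² ≥ κ
  -- > 0 on it, and a large N makes the drift term dominate H''.
  have hcomp : IsCompact (Icc (-R) R ∩ {x | h ≤ H x ∧ -c ≤ deriv (deriv H) x}) :=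
    isCompact_Icc.inter_right ((isClosed_le continuous_const hc0).inter
      (isClosed_le continuous_const hc2))
  obtain ⟨κ, hκ, hκ'⟩ := hcomp.exists_forall_le' (f := fun x => deriv H x ^ 2) (a := 0)
    (by fun_prop) (by
      rintro x ⟨-, hx1, hx2⟩
      have : deriv H x ≠ 0 := by
        intro h0
        rcases hH.deriv_eq_zero h0 with rfl | h1
        · linarith
        · rw [hH.eq_zero_of_abs_eq_one h1] at hx1; linarith
      positivity)
  refine ⟨c, hcpos, |K|, abs_nonneg _, 2 * (|K| + c) / κ, fun N hN hN0 x hx => ?_⟩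
  have hxK : deriv (deriv H) x ≤ |K| :=
    (le_abs_self _).trans ((hK x (hin x hx)).trans (le_abs_self _))
  have hsq := mul_nonneg hN0 (sq_nonneg (deriv H x))
  refine ⟨by linarith, fun hhx => ?_⟩
  by_cases hx2 : -c ≤ deriv (deriv H) x
  · have h1 := hκ' x ⟨hin x hx, hhx, hx2⟩
    rw [div_le_iff₀ hκ] at hN
    have := mul_le_mul_of_nonneg_left h1 hN0
    linarith
  · linarith

end IsDoubleWell

/-! ### Mass of superlevel sets, and concentration at time zero. -/

/-- The mass of `ρ` in the superlevel set `{h ≤ H}`. -/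
noncomputable def upperMass (H : ℝ → ℝ) (h : ℝ) (ρ : ProbDensity) : ℝ :=
  ∫ x, ρ x * {x | h ≤ H x}.indicator (fun _ => (1 : ℝ)) x

section upperMass

variable {H : ℝ → ℝ} (hH : IsDoubleWell H) (h : ℝ)
include hH

theorem measurableSet_upper : MeasurableSet {x | h ≤ H x} :=
  (isClosed_le continuous_const hH.continuous).measurableSet

theorem integrable_upper (ρ : ProbDensity) :
    Integrable fun x => ρ x * {x | h ≤ H x}.indicator (fun _ => (1 : ℝ)) x := by
  refine ρ.integrable_mul (F := 1) (measurable_const.indicator (measurableSet_upper hH h))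
    fun x => ?_
  by_cases hx : x ∈ {x | h ≤ H x} <;> simp [hx]

omit hH in
theorem upperMass_nonneg (ρ : ProbDensity) : 0 ≤ upperMass H h ρ :=
  integral_nonneg fun x => mul_nonneg (ρ.nonneg x) (indicator_nonneg (fun _ _ => zero_le_one) x)

/-- A function bounded by `a` on `{H < h}` and by `a + b` elsewhere has mean at most
`a + b * upperMass`. -/
theorem integral_le_add_upperMass (ρ : ProbDensity) {f : ℝ → ℝ} {a b F : ℝ} (hf : Continuous f)
    (hF : ∀ x, |f x| ≤ F) (h1 : ∀ x, H x < h → f x ≤ a) (h2 : ∀ x, f x ≤ a + b) :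
    ∫ x, ρ x * f x ≤ a + b * upperMass H h ρ := by
  have hi := integrable_upper hH h ρ
  have e : a + b * upperMass H h ρ =
      ∫ x, ρ x * (a + b * {x | h ≤ H x}.indicator (fun _ => (1 : ℝ)) x) := by
    unfold upperMass
    rw [← integral_const_mul]
    nth_rewrite 1 [← ρ.integral_const_mul a]
    rw [← integral_add (ρ.integrable.mul_const a) (hi.const_mul b)]
    congr 1; ext x; ring
  rw [e]
  refine ρ.integral_mono (ρ.integrable_mul hf.measurable hF) ?_ fun x => ?_
  · refine ((ρ.integrable.mul_const a).add (hi.const_mul b)).congr (ae_of_all _ fun x => ?_)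
    simp only [Pi.add_apply]; ring
  · by_cases hx : x ∈ {x | h ≤ H x}
    · simpa [hx] using h2 x
    · simpa [hx] using h1 x (not_le.1 hx)

/-- Markov's inequality. -/
theorem mul_upperMass_le (ρ : ProbDensity) {f : ℝ → ℝ} {a F : ℝ} (hf : Continuous f)
    (hF : ∀ x, |f x| ≤ F) (h0 : ∀ x, 0 ≤ f x) (h1 : ∀ x, h ≤ H x → a ≤ f x) :
    a * upperMass H h ρ ≤ ∫ x, ρ x * f x := by
  unfold upperMass
  rw [← integral_const_mul]
  refine integral_mono ((integrable_upper hH h ρ).const_mul a)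
    (ρ.integrable_mul hf.measurable hF) fun x => ?_
  by_cases hx : x ∈ {x | h ≤ H x}
  · have := mul_le_mul_of_nonneg_left (h1 x hx) (ρ.nonneg x)
    simpa [hx, mul_comm] using this
  · simpa [hx] using mul_nonneg (ρ.nonneg x) (h0 x)

end upperMass

section gibbs

variable {H : ℝ → ℝ} (hH : IsDoubleWell H) {ε₀ : ℝ} (hε₀ : 0 < ε₀)
  (hZ : ∀ ε ∈ Ioo 0 ε₀, Integrable (fun x : ℝ => Real.exp (-H x / ε ^ 2)))
include hH hε₀ hZ

/-- The invariant measure of a superlevel set of `H` is exponentially small. -/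
theorem exists_gam_upper_le {h : ℝ} (hh : 0 < h) :
    ∃ K, ∀ ε, 0 < ε → ε ≤ ε₀ / 2 →
      ∫ x, {x | h ≤ H x}.indicator (gam H ε) x ≤ K * Real.exp (-(h / 2 * (ε ^ 2)⁻¹)) := by
  have hm := measurableSet_upper hH h
  have hH0 := hH.continuous
  have hε₁ : ε₀ / 2 ∈ Ioo 0 ε₀ := ⟨by linarith, by linarith⟩
  -- On a short interval next to the well H ≤ h/2, whence Z_ε ≥ η e^{-h/(2ε²)}.
  obtain ⟨η, hη, hη'⟩ : ∃ η > 0, ∀ x ∈ Icc 1 (1 + η), H x ≤ h / 2 := by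
    have : ∀ᶠ x in 𝓝 (1 : ℝ), H x < h / 2 := by
      refine hH.continuous.continuousAt.eventually (gt_mem_nhds ?_)
      rw [hH.well.1]; linarith
    obtain ⟨η, hη, hb⟩ := Metric.eventually_nhds_iff.1 this
    refine ⟨η / 2, by linarith, fun x hx => (hb ?_).le⟩
    rw [Real.dist_eq, abs_of_nonneg (by linarith [hx.1])]
    linarith [hx.2]
  set N₁ := ((ε₀ / 2) ^ 2)⁻¹
  set Z₁ := ∫ x, Real.exp (-H x / (ε₀ / 2) ^ 2)
  refine ⟨Z₁ * Real.exp (h * N₁) / η, fun ε hε hε1 => ?_⟩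
  have hεm : ε ∈ Ioo 0 ε₀ := ⟨hε, by linarith⟩
  set N := (ε ^ 2)⁻¹ with hN
  have hNN : N₁ ≤ N := by
    simp only [N, N₁]; gcongr
  have hZlow : η * Real.exp (-(h / 2 * N)) ≤ partitionFn H ε := by
    have h1 : ∫ x in Icc 1 (1 + η), Real.exp (-(h / 2 * N)) = η * Real.exp (-(h / 2 * N)) := by
      simp [hη.le]
    rw [← h1]
    refine (setIntegral_mono_on (integrableOn_const isCompact_Icc.measure_ne_top)
      (hZ ε hεm).integrableOn measurableSet_Icc fun x hx => ?_).trans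
      (setIntegral_le_integral (hZ ε hεm) (ae_of_all _ fun x => (Real.exp_pos _).le))
    rw [Real.exp_le_exp, div_eq_mul_inv (-H x), neg_mul, neg_le_neg_iff]
    exact mul_le_mul_of_nonneg_right (hη' x hx) (by positivity)
  have hZpos : 0 < partitionFn H ε := lt_of_lt_of_le (by positivity) hZlow
  -- Comparison with the fixed noise level ε₀/2: on {H ≥ h} the excess weight is at most
  -- e^{-h(N-N₁)}, which beats the lower bound on Z_ε by a factor of order e^{-hN/2}.
  have hnum : ∫ x, {x | h ≤ H x}.indicator (fun x => Real.exp (-H x / ε ^ 2)) x ≤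
      Z₁ * Real.exp (-(h * (N - N₁))) := by
    simp only [Z₁]
    rw [← integral_mul_const]
    refine integral_mono ((hZ ε hεm).indicator hm) ((hZ _ hε₁).mul_const _) fun x => ?_
    by_cases hx : x ∈ {x | h ≤ H x}
    · rw [indicator_of_mem hx]
      simp only
      rw [← Real.exp_add, Real.exp_le_exp, div_eq_mul_inv, div_eq_mul_inv]
      have : h ≤ H x := hx
      change -H x * N ≤ -H x * N₁ + _
      nlinarith
    · rw [indicator_of_notMem hx]
      positivity
  have e : ∫ x, {x | h ≤ H x}.indicator (gam H ε) x =
      (partitionFn H ε)⁻¹ * ∫ x, {x | h ≤ H x}.indicator (fun x => Real.exp (-H x / ε ^ 2)) x := by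
    rw [← integral_const_mul]
    congr 1; ext x
    by_cases hx : x ∈ {x | h ≤ H x} <;> simp [hx, gam]
  rw [e, inv_mul_le_iff₀ hZpos]
  refine hnum.trans ?_
  have hexp : Real.exp (-(h * (N - N₁))) =
      Real.exp (h * N₁) * (Real.exp (-(h / 2 * N)) * Real.exp (-(h / 2 * N))) := by
    rw [← Real.exp_add, ← Real.exp_add]; congr 1; ring
  have hZ1 : 0 ≤ Z₁ := integral_nonneg fun x => (Real.exp_pos _).le
  rw [hexp]
  calc Z₁ * (Real.exp (h * N₁) * (Real.exp (-(h / 2 * N)) * Real.exp (-(h / 2 * N))))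
      = (η * Real.exp (-(h / 2 * N))) *
        (Z₁ * Real.exp (h * N₁) / η * Real.exp (-(h / 2 * N))) := by field_simp
    _ ≤ _ := mul_le_mul_of_nonneg_right hZlow (by positivity)

/-- Young's inequality u ≤ δu² + δ⁻¹ is integrated against γ over {H ≥ h}. With δ = e^{-h/(4ε²)} the
Gibbs mass of that set is at most Kδ², so both terms are O(δ). -/
theorem tendsto_upperMass_initial {ρ₀ : ℝ → ProbDensity} {C c : ℝ}
    (hprep : ∀ ε ∈ Ioo 0 ε₀, IsWellPrepared H ε C c (ρ₀ ε)) {h : ℝ} (hh : 0 < h) :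
    Tendsto (fun ε => upperMass H h (ρ₀ ε)) (𝓝[>] 0) (𝓝 0) := by
  obtain ⟨K, hK⟩ := exists_gam_upper_le hH hε₀ hZ hh
  have hlim : Tendsto (fun ε : ℝ => (C + K) * Real.exp (-(h / 4 * (ε ^ 2)⁻¹))) (𝓝[>] 0) (𝓝 0) := by
    simpa using (tendsto_exp_neg_mul_inv_sq (by linarith : 0 < h / 4)).const_mul (C + K)
  refine squeeze_zero' (Eventually.of_forall fun ε => upperMass_nonneg h _) ?_ hlim
  filter_upwards [Ioc_mem_nhdsGT (half_pos hε₀)] with ε hε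
  have hεm : ε ∈ Ioo 0 ε₀ := ⟨hε.1, by linarith [hε.2]⟩
  obtain ⟨du, -, hi1, hi2, hle⟩ := (hprep ε hεm).energy
  have hτ := tau_pos hε.1
  have hZi := hZ ε hεm
  have hZpos : 0 < partitionFn H ε := integral_exp_pos hZi
  have hg : ∀ x, 0 < gam H ε x := fun x => mul_pos (inv_pos.2 hZpos) (Real.exp_pos _)
  have hgi : Integrable (gam H ε) := hZi.const_mul _
  have h2 : 0 ≤ ∫ x, gam H ε x * du x ^ 2 / tau ε :=
    integral_nonneg fun x => by have := (hg x).le; positivity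
  set δ := Real.exp (-(h / 4 * (ε ^ 2)⁻¹)) with hδ
  have hδ0 : 0 < δ := Real.exp_pos _
  have hm := measurableSet_upper hH h
  have hgu := hgi.indicator hm
  have hδ2 : Real.exp (-(h / 2 * (ε ^ 2)⁻¹)) = δ * δ := by
    rw [hδ, ← Real.exp_add]; congr 1; ring
  calc upperMass H h (ρ₀ ε)
      ≤ ∫ x, (δ * (gam H ε x * (ρ₀ ε x / gam H ε x) ^ 2) +
          δ⁻¹ * {x | h ≤ H x}.indicator (gam H ε) x) := by
        refine integral_mono (integrable_upper hH h _) ((hi1.const_mul δ).add (hgu.const_mul δ⁻¹))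
          fun x => ?_
        have hgx := hg x
        by_cases hx : x ∈ {x | h ≤ H x}
        · simp only [hx, indicator_of_mem, mul_one]
          set u := ρ₀ ε x / gam H ε x with hu
          have hρu : ρ₀ ε x = gam H ε x * u := by rw [hu]; field_simp
          have hu0 : 0 ≤ u := div_nonneg ((ρ₀ ε).nonneg x) hgx.le
          rw [hρu]
          have h3 : u ≤ δ * u ^ 2 + δ⁻¹ := by
            have : 0 ≤ δ⁻¹ * ((δ * u - 1) ^ 2 + δ * u) := by positivity
            have e : δ⁻¹ * ((δ * u - 1) ^ 2 + δ * u) = δ * u ^ 2 + δ⁻¹ - u := by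
              field_simp; ring
            linarith
          nlinarith
        · have := (hg x).le
          simp only [hx, not_false_eq_true, indicator_of_notMem, mul_zero, add_zero]
          positivity
    _ = δ * (∫ x, gam H ε x * (ρ₀ ε x / gam H ε x) ^ 2) +
          δ⁻¹ * ∫ x, {x | h ≤ H x}.indicator (gam H ε) x := by
        rw [integral_add (hi1.const_mul δ) (hgu.const_mul δ⁻¹), integral_const_mul,
          integral_const_mul]
    _ ≤ δ * C + δ⁻¹ * (K * (δ * δ)) := by
        have := hK ε hε.1 hε.2
        rw [hδ2] at this
        gcongr
        linarith
    _ = (C + K) * δ := by field_simp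

end gibbs

/-! ### Lyapunov functions and propagation of concentration. -/

/-- A Lyapunov function: an increasing function of `H`, equal to one on `{M ≤ H}`. -/
noncomputable def lyap (H : ℝ → ℝ) (M n x : ℝ) : ℝ :=
  Real.exp (-(n * M / 6 * (max (1 - H x / M) 0) ^ 3))

/-- First derivative of `lyap`. -/
noncomputable def lyap₁ (H : ℝ → ℝ) (M n x : ℝ) : ℝ :=
  lyap H M n x * (n / 2 * (max (1 - H x / M) 0) ^ 2 * deriv H x)

/-- Second derivative of `lyap`. -/
noncomputable def lyap₂ (H : ℝ → ℝ) (M n x : ℝ) : ℝ :=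
  lyap H M n x * (n / 2 * (max (1 - H x / M) 0) ^ 2 * deriv H x) ^ 2 + lyap H M n x *
    (n / 2 * (max (1 - H x / M) 0) ^ 2 * deriv (deriv H) x
      - n / M * max (1 - H x / M) 0 * deriv H x ^ 2)

section lyap

variable {H : ℝ → ℝ} (hH : IsDoubleWell H) {M n : ℝ}

theorem lyap_pos (x : ℝ) : 0 < lyap H M n x := Real.exp_pos _

theorem lyap_le_one (hM : 0 ≤ M) (hn : 0 ≤ n) (x : ℝ) : lyap H M n x ≤ 1 := by
  have h0 : 0 ≤ max (1 - H x / M) 0 := le_max_right _ _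
  rw [lyap, Real.exp_le_one_iff]
  have : 0 ≤ n * M / 6 * (max (1 - H x / M) 0) ^ 3 := by positivity
  linarith

theorem abs_lyap_le_one (hM : 0 ≤ M) (hn : 0 ≤ n) (x : ℝ) : |lyap H M n x| ≤ 1 := by
  rw [abs_of_pos (lyap_pos x)]; exact lyap_le_one hM hn x

theorem lyap_eq_one (hM : 0 < M) {x : ℝ} (hx : M ≤ H x) : lyap H M n x = 1 := by
  have : 1 ≤ H x / M := (one_le_div hM).2 hx
  rw [lyap, max_eq_right (by linarith)]
  simp

theorem lyap_le_of_le (hM : 0 ≤ M) (hn : 0 ≤ n) {x h : ℝ} (hx : H x ≤ h) :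
    lyap H M n x ≤ Real.exp (-(n * M / 6 * (max (1 - h / M) 0) ^ 3)) := by
  rw [lyap, Real.exp_le_exp, neg_le_neg_iff]
  have : max (1 - h / M) 0 ≤ max (1 - H x / M) 0 := by gcongr
  have h0 : 0 ≤ max (1 - h / M) 0 := le_max_right _ _
  gcongr

theorem le_lyap_of_le (hM : 0 ≤ M) (hn : 0 ≤ n) {x h : ℝ} (hx : h ≤ H x) :
    Real.exp (-(n * M / 6 * (max (1 - h / M) 0) ^ 3)) ≤ lyap H M n x := by
  rw [lyap, Real.exp_le_exp, neg_le_neg_iff]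
  have : max (1 - H x / M) 0 ≤ max (1 - h / M) 0 := by gcongr
  have h0 : 0 ≤ max (1 - H x / M) 0 := le_max_right _ _
  gcongr

include hH

theorem hasDerivAt_lyap (hM : 0 < M) (x : ℝ) : HasDerivAt (lyap H M n) (lyap₁ H M n x) x := by
  have h1 := ((hH.hasDerivAt x).div_const M).const_sub 1
  have h2 := (hasDerivAt_max_zero_pow 1 (1 - H x / M)).comp x h1
  have h3 := ((h2.const_mul (n * M / 6)).neg).exp
  refine h3.congr_deriv ?_
  simp only [lyap₁, lyap, Function.comp, Pi.neg_apply]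
  push_cast
  field_simp
  ring_nf

theorem hasDerivAt_lyap₁ (hM : 0 < M) (x : ℝ) :
    HasDerivAt (lyap₁ H M n) (lyap₂ H M n x) x := by
  have h1 := ((hH.hasDerivAt x).div_const M).const_sub 1
  have h2 := ((hasDerivAt_max_zero_pow 0 (1 - H x / M)).comp x h1).const_mul (n / 2)
  have h3 := (hasDerivAt_lyap hH hM x (n := n)).mul (h2.mul (hH.hasDerivAt_deriv x))
  refine h3.congr_deriv ?_
  simp only [lyap₂, lyap₁, Function.comp, Pi.mul_apply]
  push_cast
  field_simp
  ring_nf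

theorem isTestFn_lyap (hM : 0 < M) (hn : 0 ≤ n) {R : ℝ} (hR : ∀ x, R < |x| → M < H x) :
    IsTestFn (lyap H M n) (lyap₁ H M n) (lyap₂ H M n) R where
  deriv₁ := hasDerivAt_lyap hH hM
  deriv₂ := hasDerivAt_lyap₁ hH hM
  cont := by
    have h0 := hH.continuous
    have h1 := hH.continuous_deriv
    have h2 := hH.continuous_deriv2
    unfold lyap₂ lyap
    fun_prop
  supp x hx := by
    have : 1 ≤ H x / M := (one_le_div hM).2 (hR x hx).le
    rw [lyap₁, max_eq_right (by linarith)]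
    simp
  bdd := ⟨1, abs_lyap_le_one hM.le hn⟩

/-- With m = (1 − H/M)₊, the square of the logarithmic derivative of V contributes n m² H'²/2 to the
bracket, at most half of the drift term ε⁻²H'² since n m² ≤ n ≤ ε⁻². The term −(n/M) m H'² has a
good sign and is dropped. -/
theorem gen_lyap_le (hM : 0 < M) (hn : 0 ≤ n) {ε : ℝ} (hε : 0 < ε) (hnε : n ≤ (ε ^ 2)⁻¹) (x : ℝ) :
    gen H ε (lyap₁ H M n) (lyap₂ H M n) x ≤ (tau ε)⁻¹ * (lyap H M n x * (n / 2) *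
      ((max (1 - H x / M) 0) ^ 2 *
        (deriv (deriv H) x - (ε ^ 2)⁻¹ / 2 * deriv H x ^ 2))) := by
  have hτ := inv_pos.2 (tau_pos hε)
  unfold gen
  refine mul_le_mul_of_nonneg_left ?_ hτ.le
  have hV := lyap_pos (H := H) (M := M) (n := n) x
  have hH0 : 0 ≤ H x / M := div_nonneg (hH.nonneg x) hM.le
  have h0 : 0 ≤ max (1 - H x / M) 0 := le_max_right _ _
  have h1 : max (1 - H x / M) 0 ≤ 1 := max_le (by linarith) zero_le_one
  unfold lyap₂ lyap₁
  set m := max (1 - H x / M) 0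
  set V := lyap H M n x
  have hm2 : m ^ 2 ≤ 1 := pow_le_one₀ h0 h1
  have k1 : 0 ≤ V * (n / M * m * deriv H x ^ 2) := by positivity
  have k2 : 0 ≤ (ε ^ 2)⁻¹ - n * m ^ 2 := by nlinarith
  have k3 : 0 ≤ V * (n / 4) * (m ^ 2 * deriv H x ^ 2) * ((ε ^ 2)⁻¹ - n * m ^ 2) := by positivity
  linarith

end lyap

section concentration

variable {H : ℝ → ℝ} (hH : IsDoubleWell H) {ε₀ : ℝ} (hε₀ : 0 < ε₀)
  (hZ : ∀ ε ∈ Ioo 0 ε₀, Integrable (fun x : ℝ => Real.exp (-H x / ε ^ 2)))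
  {ρ : ℝ → ℝ → ProbDensity} {ρ₀ : ℝ → ProbDensity}
  (hρ : ∀ ε ∈ Ioo 0 ε₀, IsSolution H ε (ρ ε) (ρ₀ ε))
  {C c : ℝ} (hprep : ∀ ε ∈ Ioo 0 ε₀, IsWellPrepared H ε C c (ρ₀ ε))
include hH hε₀ hZ hρ hprep

/-- Here V has exponent n = N = ε⁻². In the wells V ≤ e^{-3N/2}, which beats the time scale τ⁻¹ =
N⁻¹e^N, so LV ≤ K e^{-N/2}; elsewhere LV ≤ 0. Hence the mean of V, which is 1 on {H ≥ 12}, hardly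
grows up to time T. -/
theorem eventually_upperMass_twelve_le (T : ℝ) {δ : ℝ} (hδ : 0 < δ) :
    ∀ᶠ ε in 𝓝[>] 0, ∀ t, 0 < t → t ≤ T → upperMass H 12 (ρ ε t) ≤ δ := by
  have hZ₁ := hZ (ε₀ / 2) ⟨by linarith, by linarith⟩
  obtain ⟨R, hR⟩ := hH.exists_outside hZ₁ 12
  obtain ⟨κ, hκ, K, hK0, N₀, hN₀⟩ := hH.exists_bracket_bound hZ₁ 12 (h := 1 / 2) (by norm_num)
  have hlim : Tendsto (fun ε : ℝ => Real.exp (-(1 * (ε ^ 2)⁻¹)) + 1 * upperMass H (1 / 2) (ρ₀ ε)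
      + K * Real.exp (-(1 / 2 * (ε ^ 2)⁻¹)) * T) (𝓝[>] 0) (𝓝 0) := by
    have h1 := tendsto_exp_neg_mul_inv_sq (a := 1) one_pos
    have h2 := (tendsto_upperMass_initial hH hε₀ hZ hprep (h := 1 / 2) (by norm_num)).const_mul 1
    have h3 := ((tendsto_exp_neg_mul_inv_sq (a := 1 / 2) (by norm_num)).const_mul K).mul_const T
    simpa using (h1.add h2).add h3
  filter_upwards [Ioo_mem_nhdsGT hε₀, tendsto_inv_sq_atTop.eventually_ge_atTop N₀,
    hlim.eventually (gt_mem_nhds hδ)] with ε hε hN hsmall t ht htT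
  have hε0 := hε.1
  have hsol := hρ ε hε
  set N := (ε ^ 2)⁻¹ with hNdef
  have hNpos : 0 < N := by positivity
  have htest := isTestFn_lyap hH (M := 12) (n := N) (by norm_num) hNpos.le hR
  have hτ : (tau ε)⁻¹ = N⁻¹ * Real.exp N := by
    rw [tau, mul_inv, ← Real.exp_neg, hNdef, neg_div, neg_neg, one_div]
  -- With M = 12 the exponent is 2N m³, and (23/24)³ > 3/4 gives the 3N/2 above the barrier height.
  have hm23 : max (1 - 1 / 2 / 12 : ℝ) 0 = 23 / 24 := by norm_num
  have hwell : ∀ x, H x < 1 / 2 → lyap H 12 N x ≤ Real.exp (-(3 / 2 * N)) := fun x hx => by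
    refine (lyap_le_of_le (by norm_num) hNpos.le hx.le).trans ?_
    rw [hm23, Real.exp_le_exp]
    nlinarith
  have hgen : ∀ x, gen H ε (lyap₁ H 12 N) (lyap₂ H 12 N) x ≤ K * Real.exp (-(1 / 2 * N)) := by
    intro x
    refine (gen_lyap_le hH (by norm_num) hNpos.le hε0 le_rfl x).trans ?_
    have hV := lyap_pos (H := H) (M := 12) (n := N) x
    have h0 : 0 ≤ max (1 - H x / 12) 0 := le_max_right _ _
    have h1 : max (1 - H x / 12) 0 ≤ 1 := max_le (by linarith [hH.nonneg x]) zero_le_one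
    have hτ0 := inv_pos.2 (tau_pos hε0)
    have hrhs : 0 ≤ K * Real.exp (-(1 / 2 * N)) := by positivity
    rcases lt_or_ge (H x) (1 / 2) with hx | hx
    · have hb := (hN₀ N hN hNpos.le x (by linarith)).1
      have hm2 := pow_le_one₀ h0 h1 (n := 2)
      have hmb : (max (1 - H x / 12) 0) ^ 2 * (deriv (deriv H) x - N / 2 * deriv H x ^ 2) ≤ K := by
        nlinarith [pow_nonneg h0 2]
      calc _ ≤ (tau ε)⁻¹ * (lyap H 12 N x * (N / 2) * K) := by gcongr
        _ ≤ (tau ε)⁻¹ * (Real.exp (-(3 / 2 * N)) * (N / 2) * K) := by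
            have := hwell x hx
            gcongr
        _ = K / 2 * (Real.exp N * Real.exp (-(3 / 2 * N))) := by rw [hτ]; field_simp
        _ = K / 2 * Real.exp (-(1 / 2 * N)) := by rw [← Real.exp_add]; congr 2; ring
        _ ≤ _ := by gcongr; linarith
    · refine le_trans ?_ hrhs
      refine mul_nonpos_of_nonneg_of_nonpos hτ0.le (mul_nonpos_of_nonneg_of_nonpos (by positivity) ?_)
      rcases le_or_gt (H x) 12 with hx' | hx'
      · have hb := (hN₀ N hN hNpos.le x hx').2 hx
        exact mul_nonpos_of_nonneg_of_nonpos (by positivity) (by linarith)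
      · rw [max_eq_right (by linarith)]; simp
  set b := K * Real.exp (-(1 / 2 * N)) with hb
  have hbound := abs_lyap_le_one (H := H) (M := 12) (n := N) (by norm_num) hNpos.le
  have hy := le_of_hasDerivAt_nonpos (z := fun t => (∫ x, ρ ε t x * lyap H 12 N x) - b * t)
    (z₀ := ∫ x, ρ₀ ε x * lyap H 12 N x) ht
    (fun t ht => (hsol.hasDerivAt_integral hH hε0 htest ht).sub ((hasDerivAt_id t).const_mul b))
    (by
      have c : Continuous fun t : ℝ => b * t := by fun_prop
      have := (hsol.tendsto_integral htest.continuous hbound).sub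
        ((c.tendsto 0).mono_left nhdsWithin_le_nhds)
      simpa using this)
    (fun s hs _ => by
      have cg := hH.continuous_gen (ε := ε) htest.continuous₁ htest.cont
      obtain ⟨B, -, hB⟩ := exists_bound_of_outside cg (htest.gen_supp H ε)
      have := (ρ ε s).integral_mono ((ρ ε s).integrable_mul cg.measurable hB)
        ((ρ ε s).integrable.mul_const b) hgen
      rw [(ρ ε s).integral_const_mul] at this
      linarith)
  have hlow := mul_upperMass_le hH 12 (ρ ε t) htest.continuous hbound (a := 1)
    (fun x => (lyap_pos x).le) (fun x hx => (lyap_eq_one (by norm_num) hx).ge)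
  have hini := integral_le_add_upperMass hH (1 / 2) (ρ₀ ε) htest.continuous hbound
    (a := Real.exp (-(1 * N))) (b := 1)
    (fun x hx => (hwell x hx).trans (by rw [Real.exp_le_exp]; linarith))
    (fun x => by linarith [le_of_abs_le (hbound x), Real.exp_pos (-(1 * N))])
  have hbt : b * t ≤ b * T := by gcongr
  linarith

/-- Solutions concentrate at the wells, uniformly on bounded time intervals. -/
theorem eventually_upperMass_le (T : ℝ) {h δ : ℝ} (hh : 0 < h) (hh1 : h ≤ 1) (hδ : 0 < δ) :
    ∀ᶠ ε in 𝓝[>] 0, ∀ t, 0 ≤ t → t ≤ T → upperMass H h (ρ ε t) ≤ δ := by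
  have hZ₁ := hZ (ε₀ / 2) ⟨by linarith, by linarith⟩
  obtain ⟨R, hR⟩ := hH.exists_outside hZ₁ 24
  obtain ⟨κ, hκ, K, hK0, N₀, hN₀⟩ := hH.exists_bracket_bound hZ₁ 24 (half_pos hh)
  -- With M = 24 the exponent is 4n m³: V ≥ e^{-4nα} on {H ≥ h} and V ≤ e^{-4nβ} on {H < h/2}. As α
  -- < β, a large n makes the second negligible against the first, and n need not depend on ε.
  set α := (max (1 - h / 24) 0) ^ 3 with hα
  set β := (max (1 - h / 2 / 24) 0) ^ 3 with hβ
  have hαβ : α < β := by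
    rw [hα, hβ, max_eq_left (by linarith), max_eq_left (by linarith)]
    exact pow_lt_pow_left₀ (by linarith) (by linarith) (by norm_num)
  set K' := 4 * K / κ + 1 with hK'
  have hK'1 : 0 < K' := by positivity
  obtain ⟨n, hn0, hn⟩ : ∃ n : ℝ, 0 < n ∧ (K' + 1) * Real.exp (-(n * (4 * (β - α)))) < δ / 2 := by
    have : Tendsto (fun n : ℝ => (K' + 1) * Real.exp (-(n * (4 * (β - α))))) atTop (𝓝 0) := by
      simpa using (Real.tendsto_exp_neg_atTop_nhds_zero.comp
        (tendsto_id.atTop_mul_const (by linarith : 0 < 4 * (β - α)))).const_mul (K' + 1)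
    obtain ⟨n, h1, h2⟩ := ((eventually_gt_atTop 0).and
      (this.eventually (gt_mem_nhds (half_pos hδ)))).exists
    exact ⟨n, h1, h2⟩
  set δ₁ := δ / 4 * Real.exp (-(n * 4 * α)) with hδ₁
  have hδ₁0 : 0 < δ₁ := by positivity
  filter_upwards [Ioo_mem_nhdsGT hε₀, tendsto_inv_sq_atTop.eventually_ge_atTop N₀,
    tendsto_inv_sq_atTop.eventually_ge_atTop n,
    eventually_upperMass_twelve_le hH hε₀ hZ hρ hprep T hδ₁0,
    (tendsto_upperMass_initial hH hε₀ hZ hprep (half_pos hh)).eventually (gt_mem_nhds hδ₁0),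
    (tendsto_upperMass_initial hH hε₀ hZ hprep hh).eventually (gt_mem_nhds hδ)]
    with ε hε hN hNn hfar hini hini' t ht htT
  have hε0 := hε.1
  have hsol := hρ ε hε
  rcases ht.eq_or_lt with rfl | ht
  · rw [hsol.initial]; exact hini'.le
  have htest := isTestFn_lyap hH (M := 24) (n := n) (by norm_num) hn0.le hR
  have hbound := abs_lyap_le_one (H := H) (M := 24) (n := n) (by norm_num) hn0.le
  set w := Real.exp (-(n * 4 * β)) with hw
  have hw0 : 0 < w := Real.exp_pos _
  have hwell : ∀ x, H x < h / 2 → lyap H 24 n x ≤ w := fun x hx => by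
    refine (lyap_le_of_le (by norm_num) hn0.le hx.le).trans (le_of_eq ?_)
    rw [hw, hβ]; congr 2; ring
  have hτ0 := inv_pos.2 (tau_pos hε0)
  -- The factor is (n/2)·(κ/4): m ≥ 1/2 on {H < 12}, and the bracket is at most −κ between the wells
  -- and that level.
  set Λ := (tau ε)⁻¹ * (n * κ / 8) with hΛ
  have hΛ0 : 0 < Λ := by positivity
  set I := fun x => {x | 12 ≤ H x}.indicator (fun _ => (1 : ℝ)) x with hI
  have hI0 : ∀ x, 0 ≤ I x := fun x => indicator_nonneg (fun _ _ => zero_le_one) x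
  -- Three regions: in the wells the positive part of LV is absorbed by K'w (the +1 in K' pays for
  -- −V); for h/2 ≤ H < 12 there is contraction; on {H ≥ 12}, where m may degenerate, the indicator
  -- dominates, and its mean is at most δ₁ by the previous lemma.
  have hgen : ∀ x, gen H ε (lyap₁ H 24 n) (lyap₂ H 24 n) x ≤
      Λ * (-lyap H 24 n x + I x + K' * w) := by
    intro x
    refine (gen_lyap_le hH (by norm_num) hn0.le hε0 hNn x).trans ?_
    rw [hΛ, mul_assoc (tau ε)⁻¹ (n * κ / 8)]
    refine mul_le_mul_of_nonneg_left ?_ hτ0.le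
    have hV := lyap_pos (H := H) (M := 24) (n := n) x
    have hV1 := lyap_le_one (H := H) (M := 24) (n := n) (by norm_num) hn0.le x
    have h0 : 0 ≤ max (1 - H x / 24) 0 := le_max_right _ _
    have h1 : max (1 - H x / 24) 0 ≤ 1 := max_le (by linarith [hH.nonneg x]) zero_le_one
    have hNpos : 0 ≤ (ε ^ 2)⁻¹ := by positivity
    have hm2 := pow_le_one₀ h0 h1 (n := 2)
    have hK'w : 0 < K' * w := by positivity
    rcases lt_or_ge (H x) (h / 2) with hx | hx
    · have hb := (hN₀ _ hN hNpos x (by linarith)).1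
      have hmb : (max (1 - H x / 24) 0) ^ 2 *
          (deriv (deriv H) x - (ε ^ 2)⁻¹ / 2 * deriv H x ^ 2) ≤ K := by
        nlinarith [pow_nonneg h0 2]
      have hVw := hwell x hx
      calc _ ≤ lyap H 24 n x * (n / 2) * K := by gcongr
        _ ≤ w * (n / 2) * K := by gcongr
        _ = n * κ / 8 * (4 * K / κ * w) := by field_simp; ring
        _ ≤ n * κ / 8 * (-lyap H 24 n x + I x + K' * w) := by
            gcongr
            rw [hK']
            linarith [hI0 x]
    · rcases lt_or_ge (H x) 12 with hx' | hx'
      · have hb := (hN₀ _ hN hNpos x (by linarith)).2 hx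
        have hm : 1 / 2 ≤ max (1 - H x / 24) 0 := le_max_of_le_left (by linarith)
        have hm4 : 1 / 4 ≤ (max (1 - H x / 24) 0) ^ 2 := by nlinarith
        have hmb : (max (1 - H x / 24) 0) ^ 2 *
            (deriv (deriv H) x - (ε ^ 2)⁻¹ / 2 * deriv H x ^ 2) ≤ -(κ / 4) := by nlinarith
        calc _ ≤ lyap H 24 n x * (n / 2) * (-(κ / 4)) := by gcongr
          _ = n * κ / 8 * (-lyap H 24 n x) := by ring
          _ ≤ _ := by
              gcongr
              linarith [hI0 x]
      · have hI1 : I x = 1 := indicator_of_mem (s := {x | 12 ≤ H x}) hx' _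
        refine le_trans (mul_nonpos_of_nonneg_of_nonpos (by positivity) ?_)
          (mul_nonneg (by positivity) (by rw [hI1]; linarith))
        rcases le_or_gt (H x) 24 with hx'' | hx''
        · have hb := (hN₀ _ hN hNpos x hx'').2 hx
          exact mul_nonpos_of_nonneg_of_nonpos (by positivity) (by linarith)
        · rw [max_eq_right (by linarith)]; simp
  have hexp := exp_mul_sub_le (y := fun t => ∫ x, ρ ε t x * lyap H 24 n x) (Λ := Λ)
    (B := δ₁ + K' * w) ht (fun t ht => hsol.hasDerivAt_integral hH hε0 htest ht)
    (hsol.tendsto_integral htest.continuous hbound) (fun s hs hst => by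
      have cg := hH.continuous_gen (ε := ε) htest.continuous₁ htest.cont
      obtain ⟨B, -, hB⟩ := exists_bound_of_outside cg (htest.gen_supp H ε)
      have hiV := (ρ ε s).integrable_mul htest.continuous.measurable hbound
      have hiI := integrable_upper hH 12 (ρ ε s)
      have hiw := (ρ ε s).integrable.mul_const (K' * w)
      have e : ∫ x, ρ ε s x * (Λ * (-lyap H 24 n x + I x + K' * w)) =
          Λ * (-(∫ x, ρ ε s x * lyap H 24 n x) + upperMass H 12 (ρ ε s) + K' * w) := by
        nth_rewrite 2 [← (ρ ε s).integral_const_mul (K' * w)]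
        unfold upperMass
        have hiS : Integrable fun x => -(ρ ε s x * lyap H 24 n x) +
            ρ ε s x * {x | 12 ≤ H x}.indicator (fun _ => (1 : ℝ)) x := hiV.neg.add hiI
        have hiN : Integrable fun x => -(ρ ε s x * lyap H 24 n x) := hiV.neg
        rw [← integral_neg, ← integral_add hiN hiI, ← integral_add hiS hiw,
          ← integral_const_mul]
        congr 1; ext x; simp only [hI]; ring
      have hint : Integrable fun x => ρ ε s x * (Λ * (-lyap H 24 n x + I x + K' * w)) := by
        refine (((hiV.neg.add hiI).add hiw).const_mul Λ).congr (ae_of_all _ fun x => ?_)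
        simp only [Pi.add_apply, Pi.neg_apply, hI]; ring
      have := (ρ ε s).integral_mono ((ρ ε s).integrable_mul cg.measurable hB) hint hgen
      rw [e] at this
      refine this.trans ?_
      gcongr
      linarith [hfar s hs (hst.le.trans htT)])
  have hlow := mul_upperMass_le hH h (ρ ε t) htest.continuous hbound
    (a := Real.exp (-(n * 4 * α))) (fun x => (lyap_pos x).le) (fun x hx => by
      refine le_trans (le_of_eq ?_) (le_lyap_of_le (by norm_num) hn0.le hx)
      rw [hα]; congr 2; ring)
  have hini2 := integral_le_add_upperMass hH (h / 2) (ρ₀ ε) htest.continuous hbound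
    (a := w) (b := 1) hwell (fun x => by linarith [le_of_abs_le (hbound x)])
  have hy0 : 0 ≤ ∫ x, ρ₀ ε x * lyap H 24 n x :=
    integral_nonneg fun x => mul_nonneg ((ρ₀ ε).nonneg x) (lyap_pos x).le
  -- Since e^{Λt} ≥ 1, Gronwall bounds the mean of V by B plus its initial value, whatever the size
  -- of Λ.
  have hyt : ∫ x, ρ ε t x * lyap H 24 n x ≤ δ₁ + K' * w + (w + δ₁) := by
    by_contra! hcon
    have h1 : 1 ≤ Real.exp (Λ * t) := Real.one_le_exp (by positivity)
    have h2 : 0 ≤ (∫ x, ρ ε t x * lyap H 24 n x) - (δ₁ + K' * w) := by linarith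
    have := mul_le_mul_of_nonneg_right h1 h2
    have hK'w : 0 < K' * w := by positivity
    linarith
  -- The two δ₁ make up one half of δ e^{-4nα}, and (K' + 1)w is less than the other half.
  have hfin : Real.exp (-(n * 4 * α)) * upperMass H h (ρ ε t) ≤ Real.exp (-(n * 4 * α)) * δ := by
    refine hlow.trans (hyt.trans ?_)
    have hwe : w = Real.exp (-(n * 4 * α)) * Real.exp (-(n * (4 * (β - α)))) := by
      rw [hw, ← Real.exp_add]; congr 1; ring
    have := mul_le_mul_of_nonneg_left hn.le (Real.exp_nonneg (-(n * 4 * α)))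
    rw [hδ₁, hwe]
    linarith
  exact le_of_mul_le_mul_left hfin (Real.exp_pos _)

end concentration

/-! ### Laplace's method. -/

section laplace

variable {φ φ' : ℝ → ℝ} {a : ℝ}

theorem tendsto_div_sq (h1 : ∀ z, HasDerivAt φ (φ' z) z) (h2 : HasDerivAt φ' a 0) (h0 : φ 0 = 0)
    (h0' : φ' 0 = 0) : Tendsto (fun z => φ z / z ^ 2) (𝓝[≠] 0) (𝓝 (a / 2)) := by
  have hc : Continuous φ := continuous_of_hasDerivAt h1
  refine HasDerivAt.lhopital_zero_nhdsNE (f' := φ') (g' := fun z => 2 * z)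
    (Eventually.of_forall h1)
    (Eventually.of_forall fun z => by simpa using hasDerivAt_pow 2 z) ?_ ?_ ?_ ?_
  · filter_upwards [self_mem_nhdsWithin] with z hz
    exact mul_ne_zero two_ne_zero hz
  · simpa [h0] using (hc.tendsto 0).mono_left nhdsWithin_le_nhds
  · have c : Continuous fun z : ℝ => z ^ 2 := by fun_prop
    simpa using (c.tendsto 0).mono_left nhdsWithin_le_nhds
  · have := (hasDerivAt_iff_tendsto_slope.1 h2).div_const 2
    refine this.congr' ?_
    filter_upwards [self_mem_nhdsWithin] with z hz
    simp only [slope_def_field, h0', sub_zero]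
    field_simp

/-- The limit of φ/z² gives the bound near 0, compactness of S away from 0. It supplies the Gaussian
majorant for dominated convergence. -/
theorem exists_quadratic_lower_bound (hc : Continuous φ) (ha : 0 < a)
    (hlim : Tendsto (fun z => φ z / z ^ 2) (𝓝[≠] 0) (𝓝 (a / 2))) (h0 : φ 0 = 0) (B : ℝ) {S : Set ℝ}
    (hS : IsClosed S) (hSB : S ⊆ Icc (-B) B) (hpos : ∀ z ∈ S, z ≠ 0 → 0 < φ z) :
    ∃ κ > 0, ∀ z ∈ S, κ * z ^ 2 ≤ φ z := by
  have h1 := hlim.eventually (lt_mem_nhds (by linarith : a / 4 < a / 2))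
  rw [eventually_nhdsWithin_iff, Metric.eventually_nhds_iff] at h1
  obtain ⟨η, hη, hη'⟩ := h1
  have hcomp : IsCompact (Icc (-B) B ∩ (S ∩ {z | η ≤ |z|})) :=
    isCompact_Icc.inter_right (hS.inter (isClosed_le continuous_const continuous_abs))
  obtain ⟨m, hm, hm'⟩ := hcomp.exists_forall_le' (f := φ) (a := 0) hc.continuousOn (by
    rintro z ⟨-, hz, hz'⟩
    exact hpos z hz (abs_pos.1 (hη.trans_le hz')))
  refine ⟨min (a / 4) (m / (B ^ 2 + 1)), by positivity, fun z hz => ?_⟩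
  rcases eq_or_ne z 0 with rfl | hz0
  · simp [h0]
  have hz2 : 0 < z ^ 2 := by positivity
  rcases lt_or_ge |z| η with h | h
  · have := hη' (by rwa [Real.dist_eq, sub_zero]) hz0
    rw [lt_div_iff₀ hz2] at this
    exact (mul_le_mul_of_nonneg_right (min_le_left _ _) hz2.le).trans this.le
  · have h3 := hm' z ⟨hSB hz, hz, h⟩
    have h4 : z ^ 2 ≤ B ^ 2 + 1 := by
      have := abs_le.2 (hSB hz)
      have := sq_le_sq' (abs_le.1 this).1 (abs_le.1 this).2
      linarith
    calc min (a / 4) (m / (B ^ 2 + 1)) * z ^ 2 ≤ m / (B ^ 2 + 1) * z ^ 2 :=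
          mul_le_mul_of_nonneg_right (min_le_right _ _) hz2.le
      _ ≤ m / (B ^ 2 + 1) * (B ^ 2 + 1) := by gcongr
      _ = m := by field_simp
      _ ≤ φ z := h3

/-- Laplace's method. -/
theorem tendsto_laplace (hc : Continuous φ)
    (hlim : Tendsto (fun z => φ z / z ^ 2) (𝓝[≠] 0) (𝓝 (a / 2)))
    {w w₀ : ℝ → ℝ} (hw : Measurable w) (hw1 : ∀ z, |w z| ≤ 1) {κ : ℝ} (hκ : 0 < κ)
    (hlow : ∀ z, w z ≠ 0 → κ * z ^ 2 ≤ φ z)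
    (hw₀ : ∀ y, y ≠ 0 → Tendsto (fun ε => w (ε * y)) (𝓝[>] 0) (𝓝 (w₀ y))) :
    Tendsto (fun ε : ℝ => ε⁻¹ * ∫ z, w z * Real.exp (-φ z / ε ^ 2)) (𝓝[>] 0)
      (𝓝 (∫ y, w₀ y * Real.exp (-(a / 2) * y ^ 2))) := by
  -- After the substitution z = εy the exponent converges to −(a/2)y², with majorant e^{-κy²}.
  have key : Tendsto (fun ε : ℝ => ∫ y, w (ε * y) * Real.exp (-φ (ε * y) / ε ^ 2)) (𝓝[>] 0)
      (𝓝 (∫ y, w₀ y * Real.exp (-(a / 2) * y ^ 2))) := by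
    refine tendsto_integral_filter_of_dominated_convergence (fun y => Real.exp (-κ * y ^ 2)) ?_ ?_
      (integrable_exp_neg_mul_sq hκ) ?_
    · refine Eventually.of_forall fun ε => ?_
      have h1 : Measurable fun y => w (ε * y) := hw.comp (measurable_const_mul ε)
      have h2 : Measurable φ := hc.measurable
      exact Measurable.aestronglyMeasurable (by fun_prop)
    · filter_upwards [self_mem_nhdsWithin] with ε hε
      have hε' : 0 < ε := hε
      refine ae_of_all _ fun y => ?_
      rw [norm_mul, Real.norm_eq_abs, Real.norm_eq_abs, abs_of_pos (Real.exp_pos _)]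
      by_cases h : w (ε * y) = 0
      · rw [h, abs_zero, zero_mul]; positivity
      · refine (mul_le_of_le_one_left (Real.exp_pos _).le (hw1 _)).trans ?_
        rw [Real.exp_le_exp, neg_div, neg_mul, neg_le_neg_iff, le_div_iff₀ (by positivity)]
        have := hlow _ h
        linarith [mul_pow ε y 2]
    · have : ∀ᵐ y : ℝ, y ≠ 0 := by simp [ae_iff]
      filter_upwards [this] with y hy
      refine (hw₀ y hy).mul ((Real.continuous_exp.tendsto _).comp ?_)
      have hεy : Tendsto (fun ε : ℝ => ε * y) (𝓝[>] 0) (𝓝[≠] 0) := by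
        refine tendsto_nhdsWithin_iff.2 ⟨?_, ?_⟩
        · have c : Continuous fun ε : ℝ => ε * y := by fun_prop
          simpa using (c.tendsto 0).mono_left nhdsWithin_le_nhds
        · filter_upwards [self_mem_nhdsWithin] with ε hε
          exact mul_ne_zero (ne_of_gt hε) hy
      have := ((hlim.comp hεy).mul_const (y ^ 2)).neg
      rw [← neg_mul] at this
      refine this.congr' ?_
      filter_upwards [self_mem_nhdsWithin] with ε hε
      have hε' : ε ≠ 0 := ne_of_gt hε
      simp only [Function.comp]
      field_simp
  refine key.congr' ?_
  filter_upwards [self_mem_nhdsWithin] with ε hε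
  have := Measure.integral_comp_mul_left (fun z => w z * Real.exp (-φ z / ε ^ 2)) ε
  rw [this, abs_of_pos (inv_pos.2 hε), smul_eq_mul]

end laplace

/-! ### The effective rate and Kramers' constant. -/

/-- A continuous plateau function around the right well. -/
noncomputable def plateau (x : ℝ) : ℝ := max 0 (min 1 (2 - 4 * |x - 1|))

/-- A continuous odd function, equal to `±1` near the wells `±1` and to zero elsewhere. -/
noncomputable def oddPlateau (x : ℝ) : ℝ := plateau x - plateau (-x)

theorem continuous_plateau : Continuous plateau := by unfold plateau; fun_prop

theorem continuous_oddPlateau : Continuous oddPlateau := by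
  have := continuous_plateau
  unfold oddPlateau; fun_prop

theorem plateau_nonneg (x : ℝ) : 0 ≤ plateau x := le_max_left _ _

theorem plateau_le_one (x : ℝ) : plateau x ≤ 1 := max_le zero_le_one (min_le_left _ _)

theorem plateau_eq_one {x : ℝ} (hx : |x - 1| ≤ 1 / 4) : plateau x = 1 := by
  rw [plateau, min_eq_left (by linarith)]; norm_num

theorem plateau_eq_zero {x : ℝ} (hx : 1 / 2 ≤ |x - 1|) : plateau x = 0 := by
  rw [plateau, max_eq_left ((min_le_right _ _).trans (by linarith))]

theorem plateau_eq_zero_of_le {x : ℝ} (hx : x ≤ 1 / 2) : plateau x = 0 :=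
  plateau_eq_zero (by rw [abs_of_nonpos (by linarith)]; linarith)

theorem plateau_eq_zero_of_ge {x : ℝ} (hx : 3 / 2 ≤ x) : plateau x = 0 :=
  plateau_eq_zero (by rw [abs_of_nonneg (by linarith)]; linarith)

theorem oddPlateau_neg (x : ℝ) : oddPlateau (-x) = -oddPlateau x := by
  simp [oddPlateau]

theorem oddPlateau_of_nonneg {x : ℝ} (hx : 0 ≤ x) : oddPlateau x = plateau x := by
  rw [oddPlateau, plateau_eq_zero_of_le (by linarith : -x ≤ 1 / 2), sub_zero]

theorem abs_oddPlateau_le_one (x : ℝ) : |oddPlateau x| ≤ 1 := by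
  rcases le_total 0 x with h | h
  · rw [oddPlateau_of_nonneg h, abs_of_nonneg (plateau_nonneg x)]; exact plateau_le_one x
  · rw [← abs_neg, ← oddPlateau_neg, oddPlateau_of_nonneg (by linarith),
      abs_of_nonneg (plateau_nonneg _)]
    exact plateau_le_one _

section kramersLaw

variable {H : ℝ → ℝ} (hH : IsDoubleWell H)
include hH

theorem tendsto_well_integral :
    Tendsto (fun ε : ℝ => ε⁻¹ * ∫ x, plateau x * Real.exp (-H x / ε ^ 2)) (𝓝[>] 0)
      (𝓝 (√(2 * Real.pi / deriv (deriv H) 1))) := by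
  have ha := hH.deriv2_well.1
  set a := deriv (deriv H) 1 with hadef
  have hc : Continuous fun z => H (1 + z) := hH.continuous.comp (by fun_prop)
  have hlim : Tendsto (fun z => H (1 + z) / z ^ 2) (𝓝[≠] 0) (𝓝 (a / 2)) :=
    tendsto_div_sq (φ := fun z => H (1 + z)) (φ' := fun z => deriv H (1 + z))
      (fun z => (hH.hasDerivAt (1 + z)).comp_const_add 1 z)
      (by
        have := (hH.hasDerivAt_deriv (1 + 0)).comp_const_add 1 0
        simpa [a] using this)
      (by simp [hH.well.1]) (by simp [hH.deriv_well.1])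
  obtain ⟨κ, hκ, hlow⟩ := exists_quadratic_lower_bound hc ha hlim (by simp [hH.well.1]) (1 / 2)
    isClosed_Icc (subset_refl (Icc (-(1 / 2) : ℝ) (1 / 2))) fun z hz hz0 =>
      hH.pos_of_nonneg (by linarith [hz.1]) (by simpa using hz0)
  have := tendsto_laplace hc hlim (w := fun z => plateau (1 + z)) (w₀ := fun _ => 1)
    (continuous_plateau.comp (by fun_prop)).measurable
    (fun z => by rw [abs_of_nonneg (plateau_nonneg _)]; exact plateau_le_one _) hκ
    (fun z hz => hlow z (by
      by_contra hcon
      refine hz (plateau_eq_zero ?_)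
      rw [add_sub_cancel_left]
      by_contra h
      exact hcon (abs_le.1 (not_le.1 h).le)))
    (fun y _ => by
      have c : Continuous fun ε : ℝ => plateau (1 + ε * y) := continuous_plateau.comp (by fun_prop)
      have := (c.tendsto 0).mono_left (nhdsWithin_le_nhds (s := Ioi 0))
      simpa [plateau_eq_one (x := 1)] using this)
  have e : ∫ y : ℝ, 1 * Real.exp (-(a / 2) * y ^ 2) = √(2 * Real.pi / a) := by
    simp_rw [one_mul]
    rw [integral_gaussian]; congr 1; field_simp
  rw [e] at this
  refine this.congr fun ε => ?_
  congr 1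
  exact integral_add_left_eq_self (fun x => plateau x * Real.exp (-H x / ε ^ 2)) 1

/-- The maximum point 0 is an endpoint of the interval, so only half of the Gaussian contributes. -/
theorem tendsto_barrier_integral :
    Tendsto (fun ε : ℝ => ε⁻¹ * ∫ x in (0 : ℝ)..(1 / 2), Real.exp (-(1 - H x) / ε ^ 2)) (𝓝[>] 0)
      (𝓝 (√(2 * Real.pi / |deriv (deriv H) 0|) / 2)) := by
  have ha : 0 < |deriv (deriv H) 0| := abs_pos.2 hH.deriv2_barrier.ne
  set a := |deriv (deriv H) 0| with hadef
  have haneg : a = -deriv (deriv H) 0 := abs_of_neg hH.deriv2_barrier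
  have hc : Continuous fun z => 1 - H z := continuous_const.sub hH.continuous
  have hlim : Tendsto (fun z => (1 - H z) / z ^ 2) (𝓝[≠] 0) (𝓝 (a / 2)) :=
    tendsto_div_sq (φ := fun z => 1 - H z) (φ' := fun z => -deriv H z)
      (fun z => (hH.hasDerivAt z).const_sub 1)
      (by rw [haneg]; exact (hH.hasDerivAt_deriv 0).neg)
      (by simp [hH.barrier]) (by simp [hH.deriv_barrier])
  obtain ⟨κ, hκ, hlow⟩ := exists_quadratic_lower_bound hc ha hlim (by simp [hH.barrier]) (1 / 2)
    isClosed_Icc (Icc_subset_Icc_left (by norm_num) : Icc (0 : ℝ) (1 / 2) ⊆ _) fun z hz hz0 => by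
      have := hH.strictAntiOn (by simp : (0 : ℝ) ∈ Icc 0 1) ⟨hz.1, by linarith [hz.2]⟩
        (lt_of_le_of_ne hz.1 hz0.symm)
      rw [hH.barrier] at this
      linarith
  have := tendsto_laplace hc hlim (w := (Ioc (0 : ℝ) (1 / 2)).indicator fun _ => 1)
    (w₀ := (Ioi (0 : ℝ)).indicator fun _ => 1)
    (measurable_const.indicator measurableSet_Ioc)
    (fun z => by
      by_cases hz : z ∈ Ioc (0 : ℝ) (1 / 2)
      · rw [indicator_of_mem hz, abs_one]
      · rw [indicator_of_notMem hz, abs_zero]; exact zero_le_one) hκ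
    (fun z hz => hlow z (Ioc_subset_Icc_self (mem_of_indicator_ne_zero hz)))
    (fun y hy => by
      rcases lt_or_gt_of_ne hy with hy | hy
      · refine tendsto_const_nhds.congr' ?_
        filter_upwards [self_mem_nhdsWithin] with ε hε
        have hε' : 0 < ε := hε
        rw [indicator_of_notMem (by simp [hy.le]), indicator_of_notMem]
        intro h
        exact absurd h.1 (not_lt.2 (mul_neg_of_pos_of_neg hε' hy).le)
      · refine tendsto_const_nhds.congr' ?_
        filter_upwards [Ioo_mem_nhdsGT (by positivity : 0 < 1 / (2 * y))] with ε hε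
        rw [indicator_of_mem (mem_Ioi.2 hy), indicator_of_mem]
        have := hε.2
        rw [lt_div_iff₀ (by positivity)] at this
        exact ⟨mul_pos hε.1 hy, by linarith⟩)
  have e : ∫ y : ℝ, (Ioi (0 : ℝ)).indicator (fun _ => 1) y * Real.exp (-(a / 2) * y ^ 2) =
      √(2 * Real.pi / a) / 2 := by
    have : (fun y : ℝ => (Ioi (0 : ℝ)).indicator (fun _ => 1) y * Real.exp (-(a / 2) * y ^ 2)) =
        (Ioi (0 : ℝ)).indicator fun y => Real.exp (-(a / 2) * y ^ 2) := by
      ext y; by_cases hy : y ∈ Ioi (0 : ℝ) <;>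
        simp only [hy, indicator_of_mem, not_false_eq_true, indicator_of_notMem, one_mul, zero_mul]
    rw [this, integral_indicator measurableSet_Ioi, integral_gaussian_Ioi]
    congr 2; field_simp
  rw [e] at this
  refine this.congr fun ε => ?_
  congr 1
  rw [intervalIntegral.integral_of_le (by norm_num), ← integral_indicator measurableSet_Ioc]
  congr 1; ext y
  by_cases hy : y ∈ Ioc (0 : ℝ) (1 / 2) <;>
        simp only [hy, indicator_of_mem, not_false_eq_true, indicator_of_notMem, one_mul, zero_mul]

/-- The effective transition rate at noise level `ε`. -/
noncomputable def effRate (H : ℝ → ℝ) (ε : ℝ) : ℝ :=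
  ((ε ^ 2)⁻¹ * (∫ x, plateau x * Real.exp (-H x / ε ^ 2)) *
    ∫ x in (0 : ℝ)..(1 / 2), Real.exp (-(1 - H x) / ε ^ 2))⁻¹

theorem rate_pos : 0 < rate H := by
  have h1 := hH.deriv2_well.1
  have h2 : 0 < |deriv (deriv H) 0| := abs_pos.2 hH.deriv2_barrier.ne
  have := Real.pi_pos
  unfold rate
  positivity

/-- The factor ε⁻² is shared between two Laplace integrals, and √(2π/H''(1)) · √(2π/|H''(0)|)/2 =
π/√(|H''(0)|H''(1)) = 1/k. -/
theorem tendsto_effRate : Tendsto (effRate H) (𝓝[>] 0) (𝓝 (rate H)) := by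
  have hk := rate_pos hH
  have h1 := hH.deriv2_well.1
  have h2 : 0 < |deriv (deriv H) 0| := abs_pos.2 hH.deriv2_barrier.ne
  have e : √(2 * Real.pi / deriv (deriv H) 1) * (√(2 * Real.pi / |deriv (deriv H) 0|) / 2) =
      (rate H)⁻¹ := by
    rw [mul_div_assoc', ← Real.sqrt_mul (by positivity), rate, mul_inv, inv_inv]
    have : 2 * Real.pi / deriv (deriv H) 1 * (2 * Real.pi / |deriv (deriv H) 0|) =
        (2 * Real.pi) ^ 2 / (|deriv (deriv H) 0| * deriv (deriv H) 1) := by field_simp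
    rw [this, Real.sqrt_div (by positivity), Real.sqrt_sq (by positivity)]
    field_simp
  have := ((tendsto_well_integral hH).mul (tendsto_barrier_integral hH)).inv₀
    (by rw [e]; positivity)
  rw [e, inv_inv] at this
  refine this.congr fun ε => ?_
  unfold effRate
  congr 1
  rw [← inv_pow]; ring

end kramersLaw

/-! ### The approximate eigenfunction. -/

/-- The flux `∫_y^∞ e^{-H/ε²} g` generated by the odd plateau `g`. -/
noncomputable def fluxTail (H : ℝ → ℝ) (ε y : ℝ) : ℝ :=
  -- The limit 2 stands for infinity: the plateau vanishes beyond 3/2, also for y > 2, where the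
  -- orientation is reversed.
  ∫ s in y..2, Real.exp (-H s / ε ^ 2) * oddPlateau s

/-- Derivative of the approximate eigenfunction of the generator. -/
noncomputable def eigen₁ (H : ℝ → ℝ) (ε y : ℝ) : ℝ :=
  effRate H ε * tau ε * (Real.exp (H y / ε ^ 2) * fluxTail H ε y)

/-- The approximate eigenfunction of the generator. -/
noncomputable def eigen (H : ℝ → ℝ) (ε x : ℝ) : ℝ := ∫ y in (0 : ℝ)..x, eigen₁ H ε y

/-- Second derivative of `eigen`. -/
noncomputable def eigen₂ (H : ℝ → ℝ) (ε y : ℝ) : ℝ :=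
  (ε ^ 2)⁻¹ * deriv H y * eigen₁ H ε y - effRate H ε * tau ε * oddPlateau y

section eigen

variable {H : ℝ → ℝ} (hH : IsDoubleWell H) {ε : ℝ}

include hH

theorem continuous_fluxIntegrand :
    Continuous fun s => Real.exp (-H s / ε ^ 2) * oddPlateau s := by
  have h1 := hH.continuous
  have h2 := continuous_oddPlateau
  fun_prop

theorem hasDerivAt_fluxTail (y : ℝ) :
    HasDerivAt (fluxTail H ε) (-(Real.exp (-H y / ε ^ 2) * oddPlateau y)) y := by
  have hc := continuous_fluxIntegrand hH (ε := ε)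
  exact intervalIntegral.integral_hasDerivAt_left (hc.intervalIntegrable _ _)
    hc.stronglyMeasurable.stronglyMeasurableAtFilter hc.continuousAt

/-- The integrand is odd, so its integral over [-y, y] vanishes. With `fluxTail_of_ge`, the flux
therefore vanishes near both infinities. -/
theorem fluxTail_neg (y : ℝ) : fluxTail H ε (-y) = fluxTail H ε y := by
  have hc := continuous_fluxIntegrand hH (ε := ε)
  have h1 := intervalIntegral.integral_comp_neg (a := -y) (b := y)
    fun s => Real.exp (-H s / ε ^ 2) * oddPlateau s
  simp only [oddPlateau_neg, hH.even _, mul_neg, intervalIntegral.integral_neg, neg_neg] at h1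
  have h2 := intervalIntegral.integral_add_adjacent_intervals
    (hc.intervalIntegrable (μ := volume) (-y) y) (hc.intervalIntegrable y 2)
  unfold fluxTail
  linarith

omit hH in
theorem fluxTail_of_ge {y : ℝ} (hy : 3 / 2 ≤ y) : fluxTail H ε y = 0 := by
  unfold fluxTail
  rw [intervalIntegral.integral_congr (g := fun _ => 0), intervalIntegral.integral_zero]
  intro s hs
  have : 3 / 2 ≤ s := le_trans (le_min hy (by norm_num)) hs.1
  simp [oddPlateau_of_nonneg (by linarith : 0 ≤ s), plateau_eq_zero_of_ge this]

theorem fluxTail_nonneg (y : ℝ) : 0 ≤ fluxTail H ε y := by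
  have key : ∀ y, 0 ≤ y → 0 ≤ fluxTail H ε y := by
    intro y hy
    rcases le_total (3 / 2) y with h | h
    · rw [fluxTail_of_ge h]
    · refine intervalIntegral.integral_nonneg (by linarith) fun s hs => ?_
      rw [oddPlateau_of_nonneg (hy.trans hs.1)]
      exact mul_nonneg (Real.exp_pos _).le (plateau_nonneg s)
  rcases le_total 0 y with h | h
  · exact key y h
  · rw [← fluxTail_neg hH]; exact key (-y) (by linarith)

theorem fluxTail_le {y : ℝ} (hy : 0 ≤ y) (hy2 : y ≤ 2) : fluxTail H ε y ≤ 2 := by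
  have hc := continuous_fluxIntegrand hH (ε := ε)
  calc fluxTail H ε y ≤ ∫ _ in y..2, (1 : ℝ) := by
        refine intervalIntegral.integral_mono_on hy2 (hc.intervalIntegrable _ _)
          (by simp) fun s hs => ?_
        rw [oddPlateau_of_nonneg (hy.trans hs.1)]
        refine mul_le_one₀ ?_ (plateau_nonneg s) (plateau_le_one s)
        rw [Real.exp_le_one_iff, neg_div, neg_nonpos]
        exact div_nonneg (hH.nonneg s) (sq_nonneg ε)
    _ ≤ 2 := by simp; linarith

omit hH in
theorem fluxTail_of_le_half {y : ℝ} (hy : 0 ≤ y) (hy2 : y < 1 / 2) :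
    fluxTail H ε y = ∫ x, plateau x * Real.exp (-H x / ε ^ 2) := by
  unfold fluxTail
  rw [intervalIntegral.integral_of_le (by linarith),
    setIntegral_congr_fun (g := fun x => plateau x * Real.exp (-H x / ε ^ 2)) measurableSet_Ioc
      fun s hs => by
        rw [oddPlateau_of_nonneg (hy.trans hs.1.le), mul_comm]]
  refine setIntegral_eq_integral_of_forall_compl_eq_zero fun x hx => ?_
  rcases le_or_gt x y with h | h
  · rw [plateau_eq_zero_of_le (by linarith), zero_mul]
  · have : 2 < x := by
      by_contra hcon
      exact hx ⟨h, not_lt.1 hcon⟩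
    rw [plateau_eq_zero_of_ge (by linarith), zero_mul]

theorem hasDerivAt_eigen₁ (y : ℝ) : HasDerivAt (eigen₁ H ε) (eigen₂ H ε y) y := by
  have h := ((((hH.hasDerivAt y).div_const (ε ^ 2)).exp).mul (hasDerivAt_fluxTail hH (ε := ε) y)).const_mul
    (effRate H ε * tau ε)
  refine h.congr_deriv ?_
  have e : Real.exp (H y / ε ^ 2) * Real.exp (-H y / ε ^ 2) = 1 := by
    rw [← Real.exp_add, neg_div, add_neg_cancel, Real.exp_zero]
  unfold eigen₂ eigen₁
  linear_combination -(effRate H ε * tau ε * oddPlateau y) * e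

theorem continuous_eigen₁ : Continuous (eigen₁ H ε) := continuous_of_hasDerivAt (hasDerivAt_eigen₁ hH)

theorem hasDerivAt_eigen (x : ℝ) : HasDerivAt (eigen H ε) (eigen₁ H ε x) x := by
  have hc := continuous_eigen₁ hH (ε := ε)
  exact intervalIntegral.integral_hasDerivAt_right (hc.intervalIntegrable _ _)
    hc.stronglyMeasurable.stronglyMeasurableAtFilter hc.continuousAt

theorem effRate_inv_pos (hε : 0 < ε) : 0 < (ε ^ 2)⁻¹ * (∫ x, plateau x * Real.exp (-H x / ε ^ 2)) *
    ∫ x in (0 : ℝ)..(1 / 2), Real.exp (-(1 - H x) / ε ^ 2) := by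
  have hc := hH.continuous
  have cp := continuous_plateau
  have cE : Continuous fun x => plateau x * Real.exp (-H x / ε ^ 2) := by fun_prop
  have h1 : 0 < ∫ x, plateau x * Real.exp (-H x / ε ^ 2) := by
    refine cE.integral_pos_of_hasCompactSupport_nonneg_nonzero
      (hasCompactSupport_of_outside (R := 3 / 2) fun x hx => ?_)
      (fun x => mul_nonneg (plateau_nonneg x) (Real.exp_pos _).le) (x := 1) ?_
    · rcases le_total 0 x with h | h
      · rw [abs_of_nonneg h] at hx
        rw [plateau_eq_zero_of_ge hx.le, zero_mul]
      · rw [plateau_eq_zero_of_le (by linarith), zero_mul]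
    · rw [plateau_eq_one (by norm_num), one_mul]
      exact (Real.exp_pos _).ne'
  have cB : Continuous fun x => Real.exp (-(1 - H x) / ε ^ 2) := by fun_prop
  have h2 : 0 < ∫ x in (0 : ℝ)..(1 / 2), Real.exp (-(1 - H x) / ε ^ 2) :=
    intervalIntegral.intervalIntegral_pos_of_pos (cB.intervalIntegrable _ _)
      (fun x => Real.exp_pos _) (by norm_num)
  positivity

theorem effRate_pos (hε : 0 < ε) : 0 < effRate H ε := inv_pos.2 (effRate_inv_pos hH hε)

theorem eigen₁_nonneg (hε : 0 < ε) (y : ℝ) : 0 ≤ eigen₁ H ε y :=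
  mul_nonneg (mul_nonneg (effRate_pos hH hε).le (tau_pos hε).le)
    (mul_nonneg (Real.exp_pos _).le (fluxTail_nonneg hH y))

theorem eigen₁_neg (y : ℝ) : eigen₁ H ε (-y) = eigen₁ H ε y := by
  rw [eigen₁, eigen₁, fluxTail_neg hH, hH.even]

omit hH in
theorem eigen₁_of_ge {y : ℝ} (hy : 3 / 2 ≤ y) : eigen₁ H ε y = 0 := by
  rw [eigen₁, fluxTail_of_ge hy, mul_zero, mul_zero]

theorem eigen_neg (x : ℝ) : eigen H ε (-x) = -eigen H ε x := by
  unfold eigen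
  have h1 := intervalIntegral.integral_comp_neg (a := 0) (b := x) (eigen₁ H ε)
  simp only [eigen₁_neg hH, neg_zero] at h1
  rw [h1, intervalIntegral.integral_symm]

/-- On [0, 1/2) the flux is the full plateau integral and τ e^{H/ε²} = ε⁻² e^{-(1-H)/ε²}, so
`effRate` is exactly the normalising constant. -/
theorem eigen_half (hε : 0 < ε) : eigen H ε (1 / 2) = 1 := by
  have hpos := effRate_inv_pos hH hε
  have e : ∀ᵐ y, y ∈ uIoc (0 : ℝ) (1 / 2) → eigen₁ H ε y = effRate H ε *
      ((ε ^ 2)⁻¹ * ∫ x, plateau x * Real.exp (-H x / ε ^ 2)) *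
        Real.exp (-(1 - H y) / ε ^ 2) := by
    have hne : ∀ᵐ y : ℝ, y ≠ 1 / 2 := by simp [ae_iff]
    filter_upwards [hne] with y hy hmem
    rw [uIoc_of_le (by norm_num)] at hmem
    rw [eigen₁, fluxTail_of_le_half hmem.1.le (lt_of_le_of_ne hmem.2 hy), tau]
    have : Real.exp (-(1 - H y) / ε ^ 2) = Real.exp (-1 / ε ^ 2) * Real.exp (H y / ε ^ 2) := by
      rw [← Real.exp_add]; congr 1; ring
    rw [this]; ring
  rw [eigen, intervalIntegral.integral_congr_ae e, intervalIntegral.integral_const_mul, mul_assoc]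
  exact inv_mul_cancel₀ hpos.ne'

theorem monotone_eigen (hε : 0 < ε) : Monotone (eigen H ε) :=
  monotone_of_hasDerivAt_nonneg (hasDerivAt_eigen hH) (eigen₁_nonneg hH hε)

theorem eigen_of_ge {x : ℝ} (hx : 3 / 2 ≤ x) : eigen H ε x = eigen H ε (3 / 2) := by
  have hc := continuous_eigen₁ hH (ε := ε)
  have h := intervalIntegral.integral_add_adjacent_intervals
    (hc.intervalIntegrable (μ := volume) 0 (3 / 2)) (hc.intervalIntegrable (3 / 2) x)
  have h0 : ∫ y in (3 / 2 : ℝ)..x, eigen₁ H ε y = 0 := by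
    rw [intervalIntegral.integral_congr (g := fun _ => 0), intervalIntegral.integral_zero]
    intro y hy
    rw [uIcc_of_le hx] at hy
    exact eigen₁_of_ge hy.1
  unfold eigen
  linarith

/-- The deviation of the approximate eigenfunction from `±1` outside of the barrier region. -/
theorem exists_eigen_error : ∃ η : ℝ → ℝ, Tendsto η (𝓝[>] 0) (𝓝 0) ∧ ∀ ε, 0 < ε → 0 ≤ η ε ∧
    ∀ x, 1 / 2 ≤ x → 1 ≤ eigen H ε x ∧ eigen H ε x ≤ 1 + η ε := by
  have hc0 := hH.continuous
  obtain ⟨x₀, hx₀, hmax⟩ := (isCompact_Icc (a := (1 / 2 : ℝ)) (b := 3 / 2)).exists_isMaxOn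
    ⟨1, by norm_num, by norm_num⟩ hc0.continuousOn
  -- The interval [1/2, 3/2] stays strictly between 0 and 2, the points where H reaches the barrier
  -- height.
  have hlt : H x₀ < 1 := by
    rcases le_total x₀ 1 with h | h
    · rw [← hH.barrier]
      exact hH.strictAntiOn (by simp) ⟨by linarith [hx₀.1], h⟩ (by linarith [hx₀.1])
    · rw [← hH.at_two.1]
      exact hH.strictMonoOn (mem_Ici.2 h) (mem_Ici.2 (by norm_num)) (by linarith [hx₀.2])
  set b := 1 - H x₀
  have hb : 0 < b := by simp only [b]; linarith
  -- Bound for f' on [1/2, 3/2], an interval of length one: the flux is at most 2 and τ e^{H(x₀)/ε²}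
  -- = ε⁻² e^{-b/ε²}.
  refine ⟨fun ε => effRate H ε * (2 / b * ((b * (ε ^ 2)⁻¹) ^ 1 * Real.exp (-(b * (ε ^ 2)⁻¹)))),
    ?_, fun ε hε => ⟨?_, fun x hx => ?_⟩⟩
  · have h1 := ((Real.tendsto_pow_mul_exp_neg_atTop_nhds_zero 1).comp
      (tendsto_inv_sq_atTop.const_mul_atTop hb)).const_mul (2 / b)
    simpa only [mul_zero, Function.comp] using (tendsto_effRate hH).mul h1
  · have := effRate_pos hH hε
    positivity
  · have hmono := monotone_eigen hH hε
    refine ⟨(eigen_half hH hε).symm.le.trans (hmono hx), ?_⟩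
    have hx' : eigen H ε x ≤ eigen H ε (3 / 2) := by
      rcases le_total x (3 / 2) with h | h
      · exact hmono h
      · exact (eigen_of_ge hH h).le
    refine hx'.trans ?_
    have hc := continuous_eigen₁ hH (ε := ε)
    have h := intervalIntegral.integral_add_adjacent_intervals
      (hc.intervalIntegrable (μ := volume) 0 (1 / 2)) (hc.intervalIntegrable (1 / 2) (3 / 2))
    have hhalf : ∫ y in (0 : ℝ)..(1 / 2), eigen₁ H ε y = 1 := eigen_half hH hε
    rw [hhalf] at h
    have hle : ∫ y in (1 / 2 : ℝ)..(3 / 2), eigen₁ H ε y ≤ ∫ _ in (1 / 2 : ℝ)..(3 / 2),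
        effRate H ε * (2 / b * ((b * (ε ^ 2)⁻¹) ^ 1 * Real.exp (-(b * (ε ^ 2)⁻¹)))) := by
      refine intervalIntegral.integral_mono_on (by norm_num) (hc.intervalIntegrable _ _)
        intervalIntegrable_const fun y hy => ?_
      have hHy : H y ≤ H x₀ := hmax hy
      have hr := (effRate_pos hH hε).le
      have hτ := (tau_pos hε).le
      calc eigen₁ H ε y ≤ effRate H ε * tau ε * (Real.exp (H x₀ / ε ^ 2) * 2) := by
            unfold eigen₁
            have hΓ := fluxTail_le hH (ε := ε) (by linarith [hy.1] : 0 ≤ y) (by linarith [hy.2])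
            have hΓ0 := fluxTail_nonneg hH (ε := ε) y
            gcongr
        _ = _ := by
            have : Real.exp (-(b * (ε ^ 2)⁻¹)) =
                Real.exp (-1 / ε ^ 2) * Real.exp (H x₀ / ε ^ 2) := by
              rw [← Real.exp_add]; congr 1; simp only [b]; ring
            rw [this, tau]
            field_simp
    rw [intervalIntegral.integral_const] at hle
    have e2 : ((3 : ℝ) / 2 - 1 / 2) = 1 := by norm_num
    rw [e2, one_smul] at hle
    change ∫ y in (0 : ℝ)..(3 / 2), eigen₁ H ε y ≤ _
    linarith

theorem abs_eigen_le (hε : 0 < ε) {η : ℝ}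
    (h : ∀ x, 1 / 2 ≤ x → 1 ≤ eigen H ε x ∧ eigen H ε x ≤ 1 + η) (x : ℝ) :
    |eigen H ε x| ≤ 1 + η := by
  have key : ∀ x, 0 ≤ x → |eigen H ε x| ≤ 1 + η := fun x hx => by
    have h0 : eigen H ε 0 = 0 := intervalIntegral.integral_same
    have hmono := monotone_eigen hH hε
    rw [abs_of_nonneg (h0.symm.le.trans (hmono hx))]
    exact (hmono (le_max_left x (1 / 2))).trans (h _ (le_max_right _ _)).2
  rcases le_total 0 x with hx | hx
  · exact key x hx
  · rw [← abs_neg, ← eigen_neg hH]; exact key _ (by linarith)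

theorem isTestFn_eigen (hε : 0 < ε) : IsTestFn (eigen H ε) (eigen₁ H ε) (eigen₂ H ε) (3 / 2) where
  deriv₁ := hasDerivAt_eigen hH
  deriv₂ := hasDerivAt_eigen₁ hH
  cont := by
    have h1 := hH.continuous_deriv
    have h2 := continuous_eigen₁ hH (ε := ε)
    have h3 := continuous_oddPlateau
    unfold eigen₂
    fun_prop
  supp x hx := by
    rcases le_total 0 x with h | h
    · rw [abs_of_nonneg h] at hx
      exact eigen₁_of_ge hx.le
    · rw [abs_of_nonpos h] at hx
      rw [← eigen₁_neg hH]
      exact eigen₁_of_ge hx.le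
  bdd := by
    obtain ⟨η, -, hη⟩ := exists_eigen_error hH
    exact ⟨1 + η ε, abs_eigen_le hH hε (hη ε hε).2⟩

-- An exact identity: (e^{-H/ε²}f')' = −k_ε τ e^{-H/ε²}g. The eigenfunction is approximate only
-- because f and g differ.
omit hH in
theorem gen_eigen (hε : 0 < ε) (x : ℝ) :
    gen H ε (eigen₁ H ε) (eigen₂ H ε) x = -(effRate H ε * oddPlateau x) := by
  have := (tau_pos hε).ne'
  unfold gen eigen₂
  field_simp
  ring

/-- The approximate eigenfunction is close to the odd plateau near the wells. -/
theorem abs_eigen_sub_le {η : ℝ}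
    (h : ∀ x, 1 / 2 ≤ x → 1 ≤ eigen H ε x ∧ eigen H ε x ≤ 1 + η) {x : ℝ} (hx : |(|x|) - 1| ≤ 1 / 4) :
    |eigen H ε x - oddPlateau x| ≤ η := by
  have key : ∀ x, 0 ≤ x → |x - 1| ≤ 1 / 4 → |eigen H ε x - oddPlateau x| ≤ η := fun x h0 hx => by
    rw [oddPlateau_of_nonneg h0, plateau_eq_one hx]
    obtain ⟨h1, h2⟩ := h x (by linarith [(abs_le.1 hx).1])
    rw [abs_of_nonneg (by linarith)]
    linarith
  rcases le_total 0 x with h0 | h0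
  · exact key x h0 (by rwa [abs_of_nonneg h0] at hx)
  · have := key (-x) (by linarith) (by rwa [abs_of_nonpos h0] at hx)
    rwa [eigen_neg hH, oddPlateau_neg, neg_sub_neg, abs_sub_comm] at this

end eigen

/-! ### Weak limits of concentrating densities and the limiting relaxation. -/

namespace IsDoubleWell

variable {H : ℝ → ℝ} (hH : IsDoubleWell H)
include hH

theorem exists_sublevel_subset {η : ℝ} (hη : 0 < η) (hη1 : η < 1) :
    ∃ h, 0 < h ∧ h ≤ 1 ∧ ∀ x, H x < h → |(|x|) - 1| < η := by
  have h1 : 0 < H (1 + η) := hH.pos_of_nonneg (by linarith) (by linarith)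
  have h2 : 0 < H (1 - η) := hH.pos_of_nonneg (by linarith) (by linarith)
  refine ⟨min 1 (min (H (1 + η)) (H (1 - η))), by positivity, min_le_left _ _, fun x hx => ?_⟩
  rw [lt_min_iff, lt_min_iff, ← hH.apply_abs x] at hx
  have h0 := abs_nonneg x
  rw [abs_lt]
  constructor
  · by_contra! hcon
    have := hH.strictAntiOn.antitoneOn ⟨h0, by linarith⟩
      (by constructor <;> linarith : 1 - η ∈ Icc (0 : ℝ) 1) (by linarith : |x| ≤ 1 - η)
    linarith [hx.2.2]
  · by_contra! hcon
    have := hH.strictMonoOn.monotoneOn (mem_Ici.2 (by linarith)) (mem_Ici.2 (by linarith))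
      (by linarith : 1 + η ≤ |x|)
    linarith [hx.2.1]

theorem exists_sublevel_small {r : ℝ → ℝ} (hr : Continuous r) (h1 : r 1 = 0) (h2 : r (-1) = 0)
    {δ : ℝ} (hδ : 0 < δ) : ∃ h, 0 < h ∧ h ≤ 1 ∧ ∀ x, H x < h → |r x| ≤ δ := by
  have e1 : ∀ᶠ x in 𝓝 (1 : ℝ), |r x| < δ :=
    hr.abs.continuousAt.eventually (gt_mem_nhds (by simpa [h1] using hδ))
  have e2 : ∀ᶠ x in 𝓝 (-1 : ℝ), |r x| < δ :=
    hr.abs.continuousAt.eventually (gt_mem_nhds (by simpa [h2] using hδ))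
  obtain ⟨η₁, hη₁, hb₁⟩ := Metric.eventually_nhds_iff.1 e1
  obtain ⟨η₂, hη₂, hb₂⟩ := Metric.eventually_nhds_iff.1 e2
  obtain ⟨h, h0, h1, hh⟩ := hH.exists_sublevel_subset (η := min (1 / 2) (min η₁ η₂))
    (by positivity) ((min_le_left _ _).trans_lt (by norm_num))
  refine ⟨h, h0, h1, fun x hx => ?_⟩
  have := hh x hx
  rw [lt_min_iff, lt_min_iff] at this
  rcases le_total 0 x with hx0 | hx0
  · rw [abs_of_nonneg hx0] at this
    exact (hb₁ (by rw [Real.dist_eq]; exact this.2.1)).le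
  · rw [abs_of_nonpos hx0] at this
    refine (hb₂ ?_).le
    rw [Real.dist_eq, ← abs_neg, show -(x - -1) = -x - 1 by ring]
    exact this.2.2

end IsDoubleWell

theorem abs_integral_le_add_upperMass {H : ℝ → ℝ} (hH : IsDoubleWell H) (h : ℝ) (ρ : ProbDensity)
    {f : ℝ → ℝ} {a b : ℝ} (hf : Continuous f) (ha : 0 ≤ a) (h1 : ∀ x, H x < h → |f x| ≤ a)
    (h2 : ∀ x, |f x| ≤ b) : |∫ x, ρ x * f x| ≤ a + b * upperMass H h ρ := by
  have k1 := integral_le_add_upperMass hH h ρ hf h2 (a := a) (b := b)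
    (fun x hx => (le_abs_self _).trans (h1 x hx))
    (fun x => by linarith [(le_abs_self _).trans (h2 x)])
  have k2 := integral_le_add_upperMass hH h ρ hf.neg (F := b) (by simpa using h2) (a := a) (b := b)
    (fun x hx => (neg_le_abs _).trans (h1 x hx))
    (fun x => by simp only [Pi.neg_apply]; linarith [(neg_le_abs _).trans (h2 x)])
  simp only [Pi.neg_apply, mul_neg, integral_neg] at k2
  exact abs_le.2 ⟨by linarith, k1⟩

/-- Continuous bounded functions vanishing at both wells have vanishing means under
concentrating densities. -/
theorem tendsto_integral_of_concentrating {H : ℝ → ℝ} (hH : IsDoubleWell H) {σ : ℝ → ProbDensity}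
    (hσ : ∀ h δ, 0 < h → h ≤ 1 → 0 < δ → ∀ᶠ ε in 𝓝[>] (0 : ℝ), upperMass H h (σ ε) ≤ δ)
    {r : ℝ → ℝ} (hr : Continuous r) {b : ℝ} (hb : ∀ x, |r x| ≤ b) (h1 : r 1 = 0)
    (h2 : r (-1) = 0) : Tendsto (fun ε => ∫ x, σ ε x * r x) (𝓝[>] 0) (𝓝 0) := by
  rw [Metric.tendsto_nhds]
  intro δ hδ
  have hb0 : 0 ≤ b := (abs_nonneg _).trans (hb 0)
  obtain ⟨h, h0, h1, hh⟩ := hH.exists_sublevel_small hr h1 h2 (by linarith : 0 < δ / 4)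
  filter_upwards [hσ h (δ / (4 * (b + 1))) h0 h1 (by positivity)] with ε hε
  rw [Real.dist_eq, sub_zero]
  have k := abs_integral_le_add_upperMass hH h (σ ε) hr (by linarith) hh hb
  have : b * upperMass H h (σ ε) ≤ δ / 4 := by
    calc b * upperMass H h (σ ε) ≤ (b + 1) * (δ / (4 * (b + 1))) := by
          gcongr
          · exact upperMass_nonneg h _
          · linarith
      _ = δ / 4 := by field_simp
  linarith

section limit

variable {H : ℝ → ℝ} (hH : IsDoubleWell H) {ε₀ : ℝ} (hε₀ : 0 < ε₀)
  (hZ : ∀ ε ∈ Ioo 0 ε₀, Integrable (fun x : ℝ => Real.exp (-H x / ε ^ 2)))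
  {ρ : ℝ → ℝ → ProbDensity} {ρ₀ : ℝ → ProbDensity}
  (hρ : ∀ ε ∈ Ioo 0 ε₀, IsSolution H ε (ρ ε) (ρ₀ ε))
  {C c : ℝ} (hprep : ∀ ε ∈ Ioo 0 ε₀, IsWellPrepared H ε C c (ρ₀ ε))

omit hε₀ hZ hρ hprep
include hH

/-- A weak limit of concentrating densities is carried by the two wells, so that the mean of the
odd plateau is the difference of the two masses. -/
theorem tendsto_integral_oddPlateau {σ : ℝ → ProbDensity}
    (hσ : ∀ h δ, 0 < h → h ≤ 1 → 0 < δ → ∀ᶠ ε in 𝓝[>] (0 : ℝ), upperMass H h (σ ε) ≤ δ)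
    {ρlim : ProbabilityMeasure ℝ} (hlim : Tendsto (fun ε => (σ ε).law) (𝓝[>] 0) (𝓝 ρlim)) :
    Tendsto (fun ε => ∫ x, σ ε x * oddPlateau x) (𝓝[>] 0)
      (𝓝 (2 * (ρlim : Measure ℝ).real (Ioi 0) - 1)) := by
  have hc := hH.continuous
  have hconv : ∀ (f : ℝ → ℝ) (F : ℝ), Continuous f → (∀ x, |f x| ≤ F) →
      Tendsto (fun ε => ∫ x, σ ε x * f x) (𝓝[>] 0) (𝓝 (∫ x, f x ∂(ρlim : Measure ℝ))) := by
    intro f F hf hF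
    have := ProbabilityMeasure.tendsto_iff_forall_integral_tendsto.1 hlim
      (BoundedContinuousFunction.ofNormedAddCommGroup f hf F hF)
    simpa [ProbDensity.integral_law] using this
  -- The bounded function min(1, H) vanishes exactly at the wells; its mean tends to zero, so the
  -- limit measure is carried by {−1, 1}.
  have hψ0 : ∀ x, 0 ≤ min 1 (H x) := fun x => le_min zero_le_one (hH.nonneg x)
  have hψ1 : ∀ x, |min 1 (H x)| ≤ 1 := fun x => by
    rw [abs_of_nonneg (hψ0 x)]; exact min_le_left _ _
  have cψ : Continuous fun x => min 1 (H x) := by fun_prop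
  have hzero := tendsto_nhds_unique (hconv _ 1 cψ hψ1)
    (tendsto_integral_of_concentrating hH hσ cψ hψ1 (by simp [hH.well.1]) (by simp [hH.well.2]))
  rw [integral_eq_zero_iff_of_nonneg hψ0 (Integrable.of_bound cψ.aestronglyMeasurable 1
    (ae_of_all _ hψ1))] at hzero
  have hae : ∀ᵐ x ∂(ρlim : Measure ℝ), oddPlateau x =
      2 * (Ioi (0 : ℝ)).indicator (fun _ => (1 : ℝ)) x - 1 := by
    filter_upwards [hzero] with x hx
    have hHx : H x = 0 := by
      have hx' : min 1 (H x) = 0 := hx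
      rcases min_choice 1 (H x) with h | h
      · rw [h] at hx'; norm_num at hx'
      · rwa [h] at hx'
    have hone : |x| = 1 := by
      by_contra hcon
      have := hH.pos_of_nonneg (abs_nonneg x) hcon
      rw [hH.apply_abs] at this
      linarith
    rcases le_total 0 x with h0 | h0
    · rw [abs_of_nonneg h0] at hone
      subst hone
      rw [oddPlateau_of_nonneg zero_le_one, plateau_eq_one (by norm_num),
        indicator_of_mem (by simp)]
      norm_num
    · rw [abs_of_nonpos h0] at hone
      have hx1 : x = -1 := by linarith
      subst hx1
      rw [oddPlateau_neg, oddPlateau_of_nonneg zero_le_one, plateau_eq_one (by norm_num),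
        indicator_of_notMem (by simp)]
      norm_num
  have e : ∫ x, oddPlateau x ∂(ρlim : Measure ℝ) = 2 * (ρlim : Measure ℝ).real (Ioi 0) - 1 := by
    rw [integral_congr_ae hae, integral_sub, integral_const_mul, integral_indicator_const]
    · simp
    · exact measurableSet_Ioi
    · exact ((integrable_const _).indicator measurableSet_Ioi).const_mul _
    · exact integrable_const _
  rw [← e]
  exact hconv _ 1 continuous_oddPlateau abs_oddPlateau_le_one

include hε₀ hZ hρ hprep

/-- The difference of the masses in the two wells relaxes exponentially with Kramers' rate. -/
theorem tendsto_integral_oddPlateau_time {m : ℝ}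
    (hini : Tendsto (fun ε => ∫ x, ρ₀ ε x * oddPlateau x) (𝓝[>] 0) (𝓝 m)) {t : ℝ} (ht : 0 ≤ t) :
    Tendsto (fun ε => ∫ x, ρ ε t x * oddPlateau x) (𝓝[>] 0)
      (𝓝 (Real.exp (-(rate H * t)) * m)) := by
  obtain ⟨η, hη0, hη⟩ := exists_eigen_error hH
  obtain ⟨h, hh0, hh1, hh⟩ := hH.exists_sublevel_subset (η := 1 / 4) (by norm_num) (by norm_num)
  have hexp : Tendsto (fun ε => Real.exp (-(effRate H ε * t))) (𝓝[>] 0)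
      (𝓝 (Real.exp (-(rate H * t)))) :=
    (Real.continuous_exp.tendsto _).comp ((tendsto_effRate hH).mul_const t).neg
  have hmain := hexp.mul hini
  refine (tendsto_iff_of_dist ?_).1 hmain
  rw [Metric.tendsto_nhds]
  intro δ hδ
  filter_upwards [Ioo_mem_nhdsGT hε₀,
    eventually_upperMass_le hH hε₀ hZ hρ hprep t hh0 hh1 (by linarith : 0 < δ / 48),
    hη0.eventually (gt_mem_nhds (by linarith : 0 < δ / 16)),
    hη0.eventually (gt_mem_nhds one_pos)] with ε hε hmass hηε hη1
  have hε0 := hε.1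
  have hsol := hρ ε hε
  have hr := effRate_pos hH hε0
  have hf := isTestFn_eigen hH hε0
  have hfb := abs_eigen_le hH hε0 (hη ε hε0).2
  set e := δ / 8 with he
  have hfc := hf.continuous
  have hgc := continuous_oddPlateau
  have hdc : Continuous fun x => eigen H ε x - oddPlateau x := hfc.sub hgc
  -- Near the wells f − g is at most η < δ/16; elsewhere it is at most 3, on mass at most δ/48. The
  -- sum is at most e = δ/8.
  have hclose : ∀ s, 0 ≤ s → s ≤ t → |∫ x, ρ ε s x * (eigen H ε x - oddPlateau x)| ≤ e := by
    intro s hs hst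
    have hm := hmass s hs hst
    have hm0 := upperMass_nonneg (H := H) h (ρ ε s)
    have := abs_integral_le_add_upperMass hH h (ρ ε s) hdc (a := η ε) (b := 3) (hη ε hε0).1
      (fun x hx => abs_eigen_sub_le hH (hη ε hε0).2 (hh x hx).le)
      (fun x => (abs_sub _ _).trans (by linarith [hfb x, abs_oddPlateau_le_one x]))
    linarith
  have hif : ∀ s, Integrable fun x => ρ ε s x * eigen H ε x := fun s =>
    (ρ ε s).integrable_mul hfc.measurable hfb
  have hig : ∀ s, Integrable fun x => ρ ε s x * oddPlateau x := fun s =>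
    (ρ ε s).integrable_mul hgc.measurable abs_oddPlateau_le_one
  have hsplit : ∀ s, ∫ x, ρ ε s x * (eigen H ε x - oddPlateau x) =
      (∫ x, ρ ε s x * eigen H ε x) - ∫ x, ρ ε s x * oddPlateau x := fun s => by
    simp_rw [mul_sub]; exact integral_sub (hif s) (hig s)
  have hder : ∀ s, 0 < s → HasDerivAt (fun s => ∫ x, ρ ε s x * eigen H ε x)
      (-(effRate H ε * ∫ x, ρ ε s x * oddPlateau x)) s := fun s hs => by
    have := hsol.hasDerivAt_integral hH hε0 hf hs
    simp_rw [gen_eigen hε0] at this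
    refine this.congr_deriv ?_
    rw [← integral_const_mul, ← integral_neg]
    congr 1; ext x; ring
  have hlim0 := hsol.tendsto_integral hfc hfb
  have hc0 := hclose 0 le_rfl ht
  rw [hsplit, abs_le, hsol.initial] at hc0
  have hct := hclose t ht le_rfl
  rw [hsplit, abs_le] at hct
  rcases ht.eq_or_lt with rfl | htpos
  · simp only [mul_zero, neg_zero, Real.exp_zero, one_mul, hsol.initial, dist_self]
    exact hδ
  -- With y = ∫ρf, closeness of ∫ρg to y gives y' ≤ k_ε(e − y), and likewise for −y. Passing from f
  -- to g at times 0 and t as well keeps the total error within 3e < δ.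
  have up := exp_mul_sub_le (Λ := effRate H ε) (B := e) htpos hder hlim0 fun s hs hst => by
    have := hclose s hs.le hst.le
    rw [hsplit, abs_le] at this
    rw [← mul_neg]
    exact mul_le_mul_of_nonneg_left (by linarith) hr.le
  have lo := exp_mul_sub_le (Λ := effRate H ε) (B := e) htpos (fun s hs => (hder s hs).neg)
    hlim0.neg fun s hs hst => by
      have := hclose s hs.le hst.le
      rw [hsplit, abs_le] at this
      simp only [Pi.neg_apply, neg_neg]
      exact mul_le_mul_of_nonneg_left (by linarith) hr.le
  have hE : Real.exp (-(effRate H ε * t)) * Real.exp (effRate H ε * t) = 1 := by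
    rw [← Real.exp_add, neg_add_cancel, Real.exp_zero]
  have hE0 := Real.exp_pos (-(effRate H ε * t))
  have hE1 : Real.exp (-(effRate H ε * t)) ≤ 1 := by
    rw [Real.exp_le_one_iff, neg_nonpos]; positivity
  have up' := mul_le_mul_of_nonneg_left up hE0.le
  have lo' := mul_le_mul_of_nonneg_left lo hE0.le
  rw [← mul_assoc, hE, one_mul] at up' lo'
  simp only [Pi.neg_apply] at up' lo'
  set E := Real.exp (-(effRate H ε * t))
  set a := ∫ x, ρ₀ ε x * eigen H ε x
  set b := ∫ x, ρ₀ ε x * oddPlateau x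
  have he0 : 0 < e := by positivity
  have q1 : E * (a - b) ≤ e := by nlinarith
  have q2 : -e ≤ E * (a - b) := by nlinarith
  have q3 : 0 ≤ E * e := by positivity
  rw [dist_zero_right, Real.norm_eq_abs, abs_of_nonneg dist_nonneg, Real.dist_eq, abs_lt]
  constructor <;> linarith

end limit

end Kramers

/-! ### Conclusion. -/

theorem theorem1 (H : ℝ → ℝ) (hH : Kramers.IsDoubleWell H)
    (ε₀ : ℝ) (hε₀ : 0 < ε₀)
    (hZ : ∀ ε ∈ Ioo 0 ε₀, Integrable (fun x : ℝ => Real.exp (-H x / ε ^ 2)))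
    (ρ : ℝ → ℝ → Kramers.ProbDensity) (ρ₀ : ℝ → Kramers.ProbDensity)
    (hρ : ∀ ε ∈ Ioo 0 ε₀, Kramers.IsSolution H ε (ρ ε) (ρ₀ ε))
    (ρlim : ProbabilityMeasure ℝ)
    (hlim : Tendsto (fun ε => (ρ₀ ε).law) (𝓝[>] 0) (𝓝 ρlim))
    (C c : ℝ) (hc : 0 < c)
    (hprep : ∀ ε ∈ Ioo 0 ε₀, Kramers.IsWellPrepared H ε C c (ρ₀ ε)) :
    ∃ u : ℝ → ℝ,
      u 0 = 2 * (ρlim : Measure ℝ).real (Ioi 0) ∧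
      (∀ t, 0 ≤ t →
        HasDerivWithinAt u (-Kramers.rate H * (u t - 1)) (Ici 0) t) ∧
      ∀ t, 0 ≤ t → 0 ≤ u t ∧ u t ≤ 2 ∧
        ∃ ν : ProbabilityMeasure ℝ,
          (ν : Measure ℝ) = ENNReal.ofReal (u t / 2) • Measure.dirac 1 +
            ENNReal.ofReal ((2 - u t) / 2) • Measure.dirac (-1) ∧
          Tendsto (fun ε => (ρ ε t).law) (𝓝[>] 0) (𝓝 ν) := by
  set p := (ρlim : Measure ℝ).real (Ioi 0) with hp
  have hp0 : 0 ≤ p := measureReal_nonneg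
  have hp1 : p ≤ 1 := measureReal_le_one
  refine ⟨fun t => 1 + Real.exp (-(Kramers.rate H * t)) * (2 * p - 1), by simp, fun t _ => ?_,
    fun t ht => ?_⟩
  · have := ((((hasDerivAt_id t).const_mul (Kramers.rate H)).neg.exp).mul_const
      (2 * p - 1)).const_add 1
    refine (this.congr_deriv ?_).hasDerivWithinAt
    simp only [Pi.neg_apply, id]
    ring
  have hE0 := Real.exp_pos (-(Kramers.rate H * t))
  have hE1 : Real.exp (-(Kramers.rate H * t)) ≤ 1 := by
    have := Kramers.rate_pos hH
    rw [Real.exp_le_one_iff, neg_nonpos]; positivity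
  have hini := Kramers.tendsto_integral_oddPlateau hH (σ := ρ₀) (fun h δ h0 _ hδ =>
    ((Kramers.tendsto_upperMass_initial hH hε₀ hZ hprep h0).eventually (gt_mem_nhds hδ)).mono
      fun _ => le_of_lt) hlim
  have hodd := Kramers.tendsto_integral_oddPlateau_time hH hε₀ hZ hρ hprep hini ht
  rw [← hp] at hodd
  set v := Real.exp (-(Kramers.rate H * t)) * (2 * p - 1) with hv
  have hv1 : v ≤ 1 := by nlinarith
  have hv0 : -1 ≤ v := by nlinarith
  refine ⟨by linarith, by linarith, ?_⟩
  have hmass : (ENNReal.ofReal ((1 + v) / 2) • Measure.dirac (1 : ℝ) +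
      ENNReal.ofReal ((2 - (1 + v)) / 2) • Measure.dirac (-1) : Measure ℝ) univ = 1 := by
    simp only [Measure.coe_add, Measure.coe_smul, Pi.add_apply, Pi.smul_apply, measure_univ,
      smul_eq_mul, mul_one]
    rw [← ENNReal.ofReal_add (by linarith) (by linarith), ← ENNReal.ofReal_one]
    congr 1; ring
  let ν : ProbabilityMeasure ℝ := ⟨_, ⟨hmass⟩⟩
  refine ⟨ν, rfl, ProbabilityMeasure.tendsto_iff_forall_integral_tendsto.2 fun φ => ?_⟩
  simp only [Kramers.ProbDensity.integral_law]
  have hlimval : ∫ x, φ x ∂(ν : Measure ℝ) =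
      (φ 1 + φ (-1)) / 2 + (φ 1 - φ (-1)) / 2 * v := by
    change ∫ x, φ x ∂(ENNReal.ofReal ((1 + v) / 2) • Measure.dirac (1 : ℝ) +
      ENNReal.ofReal ((2 - (1 + v)) / 2) • Measure.dirac (-1)) = _
    rw [integral_add_measure, integral_smul_measure, integral_smul_measure, integral_dirac,
      integral_dirac, ENNReal.toReal_ofReal (by linarith), ENNReal.toReal_ofReal (by linarith)]
    · simp only [smul_eq_mul]; ring
    · exact (φ.integrable _).smul_measure ENNReal.ofReal_ne_top
    · exact (φ.integrable _).smul_measure ENNReal.ofReal_ne_top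
  rw [hlimval]
  -- φ − (α + βg) vanishes at both wells, so concentration removes its mean and only α + β∫ρg
  -- remains.
  set α := (φ 1 + φ (-1)) / 2 with hα
  set β := (φ 1 - φ (-1)) / 2 with hβ
  have g1 : Kramers.oddPlateau 1 = 1 := by
    rw [Kramers.oddPlateau_of_nonneg zero_le_one, Kramers.plateau_eq_one (by norm_num)]
  have hgc := Kramers.continuous_oddPlateau
  have hrc : Continuous fun x => φ x - (α + β * Kramers.oddPlateau x) := by fun_prop
  have hrb : ∀ x, |φ x - (α + β * Kramers.oddPlateau x)| ≤ ‖φ‖ + (|α| + |β|) := fun x => by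
    have k1 : |φ x| ≤ ‖φ‖ := φ.norm_coe_le_norm x
    have k2 := abs_sub (φ x) (α + β * Kramers.oddPlateau x)
    have k3 := abs_add_le α (β * Kramers.oddPlateau x)
    have k4 := mul_le_of_le_one_right (abs_nonneg β) (Kramers.abs_oddPlateau_le_one x)
    rw [abs_mul] at k3
    linarith
  have hrem := Kramers.tendsto_integral_of_concentrating hH (σ := fun ε => ρ ε t)
    (fun h δ h0 h1 hδ => (Kramers.eventually_upperMass_le hH hε₀ hZ hρ hprep t h0 h1 hδ).mono
      fun ε hε => hε t ht le_rfl) hrc (b := ‖φ‖ + (|α| + |β|))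
    hrb
    (by rw [g1, hα, hβ]; ring) (by rw [Kramers.oddPlateau_neg, g1, hα, hβ]; ring)
  have hsum := (hrem.add (tendsto_const_nhds (x := α))).add (hodd.const_mul β)
  rw [zero_add] at hsum
  refine hsum.congr fun ε => ?_
  have i1 : Integrable fun x => ρ ε t x * φ x :=
    (ρ ε t).integrable_mul φ.continuous.measurable φ.norm_coe_le_norm
  have i2 := ((ρ ε t).integrable_mul hgc.measurable Kramers.abs_oddPlateau_le_one).const_mul β
  have i3 := (ρ ε t).integrable.mul_const α
  have e : ∫ x, ρ ε t x * (φ x - (α + β * Kramers.oddPlateau x)) =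
      (∫ x, ρ ε t x * φ x) - (α + β * ∫ x, ρ ε t x * Kramers.oddPlateau x) := by
    have i4 : Integrable fun x => ρ ε t x * α + β * (ρ ε t x * Kramers.oddPlateau x) := i3.add i2
    nth_rewrite 2 [← (ρ ε t).integral_const_mul α]
    rw [← integral_const_mul, ← integral_add i3 i2, ← integral_sub i1 i4]
    congr 1; ext x; ring
  rw [e]
  ring
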